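/- Fix constants $\sigma_0>0$, $\nu>0$, $C_0>0$, $\zeta\in(1,\infty)$. For each sample size $n$ let $\mathbf y=X\beta^0+\epsilon$, where $\epsilon\sim N(0,\sigma_0^2I_n)$, $X$ is an $n\times p$ design matrix with $p=p_n\le n$ that is either deterministic or random and independent of $\epsilon$, with $X^TX=nI_p$ (almost surely), and $\beta^0\in\mathbb R^p$ is deterministic; all these quantities may depend on $n$. Models are the subsets $\gamma\subseteq\{1,\dots,p\}$; the true model is $\gamma^0=\{j:\beta^0_j\ne0\}$, with $s_n=|\gamma^0|$ and $k_n=\sum_{j\in\gamma^0}(\beta_j^0)^2$. Let $p(\gamma\mid Z)$, $Z=(\mathbf y,X)$, be the posterior probability of the model $\gamma$ in the hierarchical Bayesian model $$\mathbf y\mid\beta,\sigma^2\sim N(X\beta,\sigma^2I_n),\qquad \beta_j\mid\gamma,\sigma^2\sim\begin{cases}N(0,\phi_n\sigma^2)& j\in\gamma\\ \delta_0& j\notin\gamma\end{cases}\ \text{(independently over } j),\qquad 1/\sigma^2\sim\chi^2_\nu,\qquad \gamma\sim p(\gamma),$$ where $\phi_n>0$ and $p(\cdot)$ is a probability distribution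 on the models (it may depend on $n$). Assume that $n\phi_n\to\infty$ and $\log\phi_n=O(\log n)$; that $\gamma^0\ne\emptyset$ (for all large $n$); that $p(\gamma^0)>0$ and $\max_\gamma p(\gamma)/p(\gamma^0)\le C_0$ for every $n$; and that $\psi_n>0$ is a sequence with $\min_{j\in\gamma^0}|\beta^0_j|\ge\psi_n$. Put $$a_n=n+\frac{\sigma_0^{-2}k_n}{n^{-1}+\phi_n},$$ and assume that $n\psi_n^2>\sigma_0^2\zeta a_n$ for all large $n$, that $p\to\infty$, and that (i) $\displaystyle s_n=o\left(\min\left\{\frac{(n+\nu)\log\left(n\psi_n^2/(\sigma_0^2\zeta a_n)\right)}{\log(1+n\phi_n)},\ n\psi_n^2,\ n\right\}\right)$; (ii) $p\log p=o(a_n)$. Then, as $n\to\infty$: (a) If $p^{\alpha_0(n+\nu)/a_n}=o(n\phi_n)$ for some $\alpha_0>2$, then $\max_{\gamma\ne\gamma^0}p(\gamma\mid Z)/p(\gamma^0\mid Z)\to0$ in probability. (b) If $p=o\left((n+\nu)\log\left(\frac{n\psi_n^2}{\sigma_0^2\zeta a_n}\right)\right)$ and $p^{2+\alpha_0(n+\nu)/a_n}=o(n\phi_n)$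 for some $\alpha_0>2$, then $\sum_{\gamma\ne\gamma^0}p(\gamma\mid Z)\to0$ in probability, and consequently $p(\gamma^0\mid Z)\to1$ in probability. -/

import Mathlib

open Filter Topology MeasureTheory ProbabilityTheory Asymptotics

noncomputable section

namespace BVS

/-- The model (state vector) attached to a coefficient vector: the set of indices of the nonzero
coefficients. Models on `p` covariates are the finsets of `Fin p`. -/
def supp {p : ℕ} (β : Fin p → ℝ) : Finset (Fin p) :=
  Finset.univ.filter fun j => β j ≠ 0

/-- `∑_{j ∈ supp β} β_j ^ 2`, the squared Euclidean norm of the vector of nonzero coefficients. -/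
def energy {p : ℕ} (β : Fin p → ℝ) : ℝ :=
  ∑ j ∈ supp β, β j ^ 2

/-- The law `N(0, σ² I_n)` of a vector of `n` i.i.d. centred Gaussian errors. -/
def noiseLaw (n : ℕ) (σ2 : ℝ) : Measure (Fin n → ℝ) :=
  Measure.pi fun _ => gaussianReal 0 σ2.toNNReal

/-- The chi-square distribution with `ν` degrees of freedom, i.e. the Gamma distribution with shape
`ν / 2` and rate `1 / 2`. -/
def chiSq (ν : ℝ) : Measure ℝ :=
  gammaMeasure (ν / 2) (1 / 2)

/-- The conditional prior of `β` given the model `γ` and the error variance `σ2`: the coordinates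
are independent, the `j`-th is `N(0, c_j σ2)` if `j ∈ γ` and the point mass at `0` otherwise. -/
def coefPrior {p : ℕ} (c : Fin p → ℝ) (γ : Finset (Fin p)) (σ2 : ℝ) : Measure (Fin p → ℝ) :=
  Measure.pi fun j => if j ∈ γ then gaussianReal 0 (c j * σ2).toNNReal else Measure.dirac 0

/-- The density at `y` of `N(X β, σ2 I_n)`. -/
def likelihood {n p : ℕ} (X : Matrix (Fin n) (Fin p) ℝ) (β : Fin p → ℝ) (σ2 : ℝ)
    (y : Fin n → ℝ) : ℝ :=
  ∏ i, gaussianPDFReal (X.mulVec β i) σ2.toNNReal (y i)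

/-- The marginal density of `y` under the model `γ`: the likelihood integrated over the prior of
`β` given `γ` and `σ²`, and then over the precision `τ = 1 / σ² ∼ χ²_ν`. -/
def marginal {n p : ℕ} (ν : ℝ) (c : Fin p → ℝ) (X : Matrix (Fin n) (Fin p) ℝ) (y : Fin n → ℝ)
    (γ : Finset (Fin p)) : ℝ :=
  ∫ τ, ∫ β, likelihood X β τ⁻¹ y ∂(coefPrior c γ τ⁻¹) ∂(chiSq ν)

/-- The posterior probability `p(γ | y, X)`, by Bayes' formula, for the prior weights `w` on the
models. -/
def posterior {n p : ℕ} (ν : ℝ) (c : Fin p → ℝ) (w : Finset (Fin p) → ℝ)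
    (X : Matrix (Fin n) (Fin p) ℝ) (y : Fin n → ℝ) (γ : Finset (Fin p)) : ℝ :=
  w γ * marginal ν c X y γ / ∑ γ', w γ' * marginal ν c X y γ'

/-- The maximal posterior odds `max_{γ ≠ γ₀} p(γ | y, X) / p(γ₀ | y, X)` of a wrong model. -/
def maxOdds {n p : ℕ} (ν : ℝ) (c : Fin p → ℝ) (w : Finset (Fin p) → ℝ)
    (X : Matrix (Fin n) (Fin p) ℝ) (y : Fin n → ℝ) (γ₀ : Finset (Fin p)) : ℝ :=
  ⨆ γ : {γ : Finset (Fin p) // γ ≠ γ₀}, posterior ν c w X y γ / posterior ν c w X y γ₀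

/-- `a_n = n + σ₀⁻² k / (n⁻¹ + φ)`. -/
def scaleA (σ₀ : ℝ) (n : ℕ) (k φ : ℝ) : ℝ :=
  n + (σ₀ ^ 2)⁻¹ * k / ((n : ℝ)⁻¹ + φ)

end BVS

end

/-!
Under the conjugate prior and an orthogonal design, the marginal likelihood of a model is, up to a
factor common to all models, `(1 + nφ) ^ (-1/2)` for each of its covariates times the power
`-(n + ν) / 2` of one plus its residual sum of squares (shrunken by the prior). With high
probability the squared projection of the noise onto each covariate is below about `2 σ₀² log p`,
and the squared length of the noise is about `n σ₀²`. Then the residual sum of squares of the true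
model is about `σ₀² a_n`, the second term of `a_n` being the bias due to shrinkage.

A spurious covariate reduces the residual sum of squares by at most the noise level, so it gains at
most a factor `p ^ (α₀ (n + ν) / (2 a_n))` in the odds, for which the size penalty charges
`(1 + nφ) ^ (1/2)`. Omitting a true covariate instead multiplies the residual sum of squares by at
least `n ψ_n² / (σ₀² ζ a_n)`; raised to the power `-(n + ν) / 2` this is so small that the bound on
`s_n` lets it absorb the size factor of the true model. The odds of the supersets of the true model
add up binomially, and the crude count `2 ^ p` suffices for all other models.
-/

namespace BVS

open scoped Matrix NNReal ENNReal

/-! ### Gaussian and Gamma integrals -/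

lemma integral_exp_linear_sub_quadratic_gaussianReal {m : ℝ} {v : ℝ≥0} (hmv : 0 < 1 + m * v)
    (u : ℝ) :
    ∫ b, Real.exp (u * b - m * b ^ 2 / 2) ∂gaussianReal 0 v =
      (√(1 + m * v))⁻¹ * Real.exp (v * u ^ 2 / (1 + m * v) / 2) := by
  obtain rfl | hv := eq_or_ne v 0
  · simp
  have : (0 : ℝ) < v := by positivity
  set q := 1 + m * v with hq
  have hw : 0 < v / q := by positivity
  have completed_square (b : ℝ) : -(b - 0) ^ 2 / (2 * v) + (u * b - m * b ^ 2 / 2) =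
      v * u ^ 2 / q / 2 + -(b - v * u / q) ^ 2 / (2 * (v / q)) := by
    have : m = (q - 1) / v := by rw [hq]; field_simp; ring
    rw [this]
    field_simp
    ring
  have normalization : √(2 * Real.pi * v) = √q * √(2 * Real.pi * (v / q)) := by
    rw [← Real.sqrt_mul hmv.le]
    congr 1
    field_simp
  have tilted (b : ℝ) : gaussianPDFReal 0 v b • Real.exp (u * b - m * b ^ 2 / 2) =
      (√q)⁻¹ * Real.exp (v * u ^ 2 / q / 2) *
        gaussianPDFReal (v * u / q) (v / q).toNNReal b := by
    simp only [gaussianPDFReal, Real.coe_toNNReal _ hw.le, smul_eq_mul]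
    rw [normalization, mul_inv, mul_assoc, mul_assoc, ← Real.exp_add, completed_square,
      Real.exp_add]
    ring
  simp_rw [integral_gaussianReal_eq_integral_smul hv, tilted]
  rw [integral_const_mul, integral_gaussianPDFReal_eq_one _ (by simpa using hw), mul_one]

lemma integral_gammaMeasure {E : Type*} [NormedAddCommGroup E] [NormedSpace ℝ E] {a r : ℝ}
    (ha : 0 < a) (hr : 0 < r) (f : ℝ → E) :
    ∫ τ, f τ ∂gammaMeasure a r = ∫ τ in Set.Ioi 0,
      (r ^ a / Real.Gamma a * τ ^ (a - 1) * Real.exp (-(r * τ))) • f τ := by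
  have hm : Measurable (gammaPDF a r) := (measurable_gammaPDFReal _ _).ennreal_ofReal
  rw [gammaMeasure, integral_withDensity_eq_integral_toReal_smul hm
    (ae_of_all _ fun _ => ENNReal.ofReal_lt_top), ← integral_indicator measurableSet_Ioi]
  refine integral_congr_ae ?_
  filter_upwards [compl_mem_ae_iff.2 (measure_singleton (0 : ℝ))] with τ hτ
  have := Real.Gamma_pos_of_pos ha
  rcases lt_or_gt_of_ne hτ with hneg | hpos
  · simp [gammaPDF_of_neg hneg, hneg.le]
  · rw [gammaPDF_of_nonneg hpos.le, ENNReal.toReal_ofReal (by positivity),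
      Set.indicator_of_mem (Set.mem_Ioi.2 hpos)]

lemma integral_rpow_mul_exp_neg_mul_gammaMeasure {a r s t : ℝ} (ha : 0 < a) (hr : 0 < r)
    (has : 0 < a + s) (hrt : 0 < r + t) :
    ∫ τ, τ ^ s * Real.exp (-(t * τ)) ∂gammaMeasure a r =
      r ^ a / Real.Gamma a * Real.Gamma (a + s) * (r + t) ^ (-(a + s)) := by
  have combined : ∀ τ ∈ Set.Ioi (0 : ℝ),
      (r ^ a / Real.Gamma a * τ ^ (a - 1) * Real.exp (-(r * τ))) •
        (τ ^ s * Real.exp (-(t * τ))) =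
      r ^ a / Real.Gamma a * (τ ^ (a + s - 1) * Real.exp (-((r + t) * τ))) := by
    intro τ hτ
    rw [show a + s - 1 = a - 1 + s by ring, Real.rpow_add hτ, add_mul, neg_add, Real.exp_add,
      smul_eq_mul]
    ring
  rw [integral_gammaMeasure ha hr, setIntegral_congr_fun measurableSet_Ioi combined,
    integral_const_mul, Real.integral_rpow_mul_exp_neg_mul_Ioi has hrt, one_div,
    Real.inv_rpow hrt.le, Real.rpow_neg hrt.le]
  ring

/-! ### The marginal likelihood under an orthogonal design -/

section Design
variable {n p : ℕ} {X : Matrix (Fin n) (Fin p) ℝ} {φ ν τ : ℝ}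

/-- An orthogonal design matrix, normalized so that each of its columns has squared length `n`. -/
def IsOrthogonalDesign (X : Matrix (Fin n) (Fin p) ℝ) : Prop :=
  Xᵀ * X = (n : ℝ) • (1 : Matrix _ _ ℝ)

/-- The squared length of the projection of `y` onto the `j`-th covariate, provided that the
covariate has squared length `n`. -/
noncomputable def projSq (X : Matrix (Fin n) (Fin p) ℝ) (y : Fin n → ℝ) (j : Fin p) : ℝ :=
  (Xᵀ *ᵥ y) j ^ 2 / n

/-- The factor by which the prior variance `φ σ²` shrinks the least squares coefficients. -/
noncomputable def shrinkage (n : ℕ) (φ : ℝ) : ℝ :=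
  n * φ / (1 + n * φ)

/-- The residual sum of squares of the model `γ`, its fit being shrunk by the prior. -/
noncomputable def shrunkRSS (φ : ℝ) (X : Matrix (Fin n) (Fin p) ℝ) (y : Fin n → ℝ)
    (γ : Finset (Fin p)) : ℝ :=
  ∑ i, y i ^ 2 - shrinkage n φ * ∑ j ∈ γ, projSq X y j

/-- The factor of the marginal density that is common to all models. -/
noncomputable def marginalConst (n : ℕ) (ν : ℝ) : ℝ :=
  (√(2 * Real.pi))⁻¹ ^ n * ((1 / 2) ^ (ν / 2) / Real.Gamma (ν / 2)) * Real.Gamma ((n + ν) / 2) *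
    2 ^ ((n + ν) / 2)

lemma projSq_nonneg (X : Matrix (Fin n) (Fin p) ℝ) (y : Fin n → ℝ) (j : Fin p) :
    0 ≤ projSq X y j := by
  rw [projSq]
  positivity

lemma shrinkage_nonneg (hφ : 0 ≤ φ) : 0 ≤ shrinkage n φ := by
  rw [shrinkage]
  positivity

lemma shrinkage_le_one (hφ : 0 ≤ φ) : shrinkage n φ ≤ 1 :=
  div_le_one_of_le₀ (by linarith) (by positivity)

lemma shrinkage_mul_projSq (X : Matrix (Fin n) (Fin p) ℝ) (y : Fin n → ℝ) (j : Fin p) :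
    shrinkage n φ * projSq X y j = φ / (1 + n * φ) * (Xᵀ *ᵥ y) j ^ 2 := by
  obtain rfl | hn := Nat.eq_zero_or_pos n
  · simp [projSq, Matrix.mulVec, dotProduct]
  · rw [shrinkage, projSq]
    field_simp

lemma marginalConst_pos (hν : 0 < ν) : 0 < marginalConst n ν := by
  have := Real.Gamma_pos_of_pos (show 0 < ν / 2 by positivity)
  have := Real.Gamma_pos_of_pos (show 0 < (n + ν) / 2 by positivity)
  rw [marginalConst]
  positivity

namespace IsOrthogonalDesign

lemma transpose_mulVec_mulVec (hX : IsOrthogonalDesign X) (β : Fin p → ℝ) :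
    Xᵀ *ᵥ (X *ᵥ β) = (n : ℝ) • β := by
  rw [Matrix.mulVec_mulVec, hX, Matrix.smul_mulVec, Matrix.one_mulVec]

lemma sum_sub_mulVec_sq (hX : IsOrthogonalDesign X) (y : Fin n → ℝ) (β : Fin p → ℝ) :
    ∑ i, (y i - (X *ᵥ β) i) ^ 2 =
      ∑ i, y i ^ 2 - ∑ j, (2 * β j * (Xᵀ *ᵥ y) j - n * β j ^ 2) := by
  have cross : y ⬝ᵥ X *ᵥ β = β ⬝ᵥ Xᵀ *ᵥ y := by
    rw [Matrix.dotProduct_mulVec, ← Matrix.mulVec_transpose, dotProduct_comm]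
  have fitted : X *ᵥ β ⬝ᵥ X *ᵥ β = n * (β ⬝ᵥ β) := by
    rw [Matrix.dotProduct_mulVec, ← Matrix.mulVec_transpose, hX.transpose_mulVec_mulVec,
      smul_dotProduct, smul_eq_mul]
  have expanded : (y - X *ᵥ β) ⬝ᵥ (y - X *ᵥ β) =
      y ⬝ᵥ y - (2 * (β ⬝ᵥ Xᵀ *ᵥ y) - n * (β ⬝ᵥ β)) := by
    simp only [sub_dotProduct, dotProduct_sub, dotProduct_comm (X *ᵥ β) y, cross, fitted]
    ring
  simpa only [dotProduct, Pi.sub_apply, ← sq, Finset.sum_sub_distrib, Finset.mul_sum, mul_assoc]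
    using expanded

lemma sum_projSq_le (hX : IsOrthogonalDesign X) (y : Fin n → ℝ) :
    ∑ j, projSq X y j ≤ ∑ i, y i ^ 2 := by
  obtain rfl | hn := Nat.eq_zero_or_pos n
  · simp [projSq]
  have residual := hX.sum_sub_mulVec_sq y fun j => (Xᵀ *ᵥ y) j / n
  have fit : ∑ j, (2 * ((Xᵀ *ᵥ y) j / n) * (Xᵀ *ᵥ y) j - n * ((Xᵀ *ᵥ y) j / n) ^ 2) =
      ∑ j, projSq X y j := by
    refine Finset.sum_congr rfl fun j _ => ?_
    rw [projSq]
    field_simp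
    ring
  rw [fit] at residual
  linarith [Finset.sum_nonneg fun i (_ : i ∈ Finset.univ) =>
    sq_nonneg (y i - (X *ᵥ fun j => (Xᵀ *ᵥ y) j / n) i)]

lemma shrunkRSS_nonneg (hX : IsOrthogonalDesign X) (hφ : 0 ≤ φ) (y : Fin n → ℝ)
    (γ : Finset (Fin p)) : 0 ≤ shrunkRSS φ X y γ := by
  refine sub_nonneg.2 ?_
  calc shrinkage n φ * ∑ j ∈ γ, projSq X y j ≤ ∑ j ∈ γ, projSq X y j :=
        mul_le_of_le_one_left (Finset.sum_nonneg fun j _ => projSq_nonneg X y j)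
          (shrinkage_le_one hφ)
    _ ≤ ∑ j, projSq X y j :=
        Finset.sum_le_univ_sum_of_nonneg fun j => projSq_nonneg X y j
    _ ≤ ∑ i, y i ^ 2 := hX.sum_projSq_le y

lemma likelihood_eq (hX : IsOrthogonalDesign X) (hτ : 0 < τ) (β : Fin p → ℝ) (y : Fin n → ℝ) :
    likelihood X β τ⁻¹ y =
      (√(2 * Real.pi * τ⁻¹))⁻¹ ^ n * Real.exp (-(τ / 2 * ∑ i, y i ^ 2)) *
        ∏ j, Real.exp (τ * (Xᵀ *ᵥ y) j * β j - τ * n * β j ^ 2 / 2) := by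
  have exponent : ∑ i, -(y i - (X *ᵥ β) i) ^ 2 / (2 * τ⁻¹) = -(τ / 2 * ∑ i, y i ^ 2) +
      ∑ j, (τ * (Xᵀ *ᵥ y) j * β j - τ * n * β j ^ 2 / 2) := by
    calc ∑ i, -(y i - (X *ᵥ β) i) ^ 2 / (2 * τ⁻¹)
        = -(τ / 2) * ∑ i, (y i - (X *ᵥ β) i) ^ 2 := by
          rw [Finset.mul_sum]
          refine Finset.sum_congr rfl fun i _ => ?_
          field_simp
      _ = -(τ / 2 * ∑ i, y i ^ 2) +
            τ / 2 * ∑ j, (2 * β j * (Xᵀ *ᵥ y) j - n * β j ^ 2) := by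
          rw [hX.sum_sub_mulVec_sq]
          ring
      _ = _ := by
          rw [add_right_inj, Finset.mul_sum]
          exact Finset.sum_congr rfl fun j _ => by ring
  simp only [likelihood, gaussianPDFReal, Real.coe_toNNReal _ (inv_pos.2 hτ).le]
  rw [Finset.prod_mul_distrib, ← Real.exp_sum, exponent, Real.exp_add, Real.exp_sum,
    Finset.prod_const, Finset.card_univ, Fintype.card_fin, ← mul_assoc]

end IsOrthogonalDesign

lemma integral_exp_coefPrior_coordinate (hτ : 0 < τ) (hφ : 0 ≤ φ) (y : Fin n → ℝ) (j : Fin p)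
    (γ : Finset (Fin p)) :
    ∫ b, Real.exp (τ * (Xᵀ *ᵥ y) j * b - τ * n * b ^ 2 / 2)
        ∂(if j ∈ γ then gaussianReal 0 (φ * τ⁻¹).toNNReal else Measure.dirac 0) =
      if j ∈ γ then (√(1 + n * φ))⁻¹ * Real.exp (τ / 2 * (shrinkage n φ * projSq X y j))
      else 1 := by
  split_ifs with hj
  · have hv : ((φ * τ⁻¹).toNNReal : ℝ) = φ * τ⁻¹ := Real.coe_toNNReal _ (by positivity)
    have hq : 1 + τ * n * (φ * τ⁻¹) = 1 + n * φ := by field_simp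
    rw [integral_exp_linear_sub_quadratic_gaussianReal (by positivity), hv, hq,
      shrinkage_mul_projSq]
    congr 2
    field_simp
  · simp

namespace IsOrthogonalDesign

lemma integral_likelihood_coefPrior (hX : IsOrthogonalDesign X) (hτ : 0 < τ) (hφ : 0 ≤ φ)
    (y : Fin n → ℝ) (γ : Finset (Fin p)) :
    ∫ β, likelihood X β τ⁻¹ y ∂coefPrior (fun _ => φ) γ τ⁻¹ =
      (√(2 * Real.pi * τ⁻¹))⁻¹ ^ n * (√(1 + n * φ))⁻¹ ^ γ.card *
        Real.exp (-(shrunkRSS φ X y γ / 2 * τ)) := by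
  have (j : Fin p) : SigmaFinite
      (if j ∈ γ then gaussianReal 0 (φ * τ⁻¹).toNNReal else Measure.dirac 0) := by
    split_ifs <;> infer_instance
  simp_rw [hX.likelihood_eq hτ, coefPrior, integral_const_mul]
  rw [integral_fintype_prod_eq_prod
    (f := fun j b => Real.exp (τ * (Xᵀ *ᵥ y) j * b - τ * n * b ^ 2 / 2))]
  simp_rw [integral_exp_coefPrior_coordinate hτ hφ]
  have exponent : -(shrunkRSS φ X y γ / 2 * τ) = -(τ / 2 * ∑ i, y i ^ 2) +
      ∑ j ∈ γ, τ / 2 * (shrinkage n φ * projSq X y j) := by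
    rw [shrunkRSS, ← Finset.mul_sum, ← Finset.mul_sum]
    ring
  rw [Finset.prod_ite_mem, Finset.univ_inter, Finset.prod_mul_distrib, Finset.prod_const,
    ← Real.exp_sum, exponent, Real.exp_add]
  ring

lemma marginal_eq (hX : IsOrthogonalDesign X) (hν : 0 < ν) (hφ : 0 ≤ φ) (y : Fin n → ℝ)
    (γ : Finset (Fin p)) :
    marginal ν (fun _ => φ) X y γ = marginalConst n ν *
      ((√(1 + n * φ))⁻¹ ^ γ.card * (1 + shrunkRSS φ X y γ) ^ (-((n + ν) / 2))) := by
  have hR := hX.shrunkRSS_nonneg hφ y γ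
  have normalization {τ : ℝ} (hτ : 0 < τ) :
      (√(2 * Real.pi * τ⁻¹))⁻¹ ^ n = (√(2 * Real.pi))⁻¹ ^ n * τ ^ ((n : ℝ) / 2) := by
    rw [Real.sqrt_mul (by positivity), mul_inv, Real.sqrt_inv, inv_inv, mul_pow,
      Real.rpow_div_two_eq_sqrt _ hτ.le, Real.rpow_natCast]
  have integrand : ∀ τ ∈ Set.Ioi (0 : ℝ),
      ((1 / 2 : ℝ) ^ (ν / 2) / Real.Gamma (ν / 2) * τ ^ (ν / 2 - 1) * Real.exp (-(1 / 2 * τ))) •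
        ∫ β, likelihood X β τ⁻¹ y ∂coefPrior (fun _ => φ) γ τ⁻¹ =
      ((1 / 2 : ℝ) ^ (ν / 2) / Real.Gamma (ν / 2) * τ ^ (ν / 2 - 1) * Real.exp (-(1 / 2 * τ))) •
        ((√(2 * Real.pi))⁻¹ ^ n * (√(1 + n * φ))⁻¹ ^ γ.card *
          (τ ^ ((n : ℝ) / 2) * Real.exp (-(shrunkRSS φ X y γ / 2 * τ)))) := by
    intro τ hτ
    rw [hX.integral_likelihood_coefPrior hτ hφ, normalization hτ]
    ring_nf
  have half : 0 < ν / 2 := by positivity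
  have scale : (1 / 2 + shrunkRSS φ X y γ / 2) ^ (-((n + ν) / 2)) =
      2 ^ ((n + ν) / 2) * (1 + shrunkRSS φ X y γ) ^ (-((n + ν) / 2)) := by
    rw [← add_div, Real.div_rpow (by positivity) zero_le_two, Real.rpow_neg zero_le_two,
      div_inv_eq_mul, mul_comm]
  rw [marginal, chiSq, integral_gammaMeasure half one_half_pos,
    setIntegral_congr_fun measurableSet_Ioi integrand, ← integral_gammaMeasure half one_half_pos,
    integral_const_mul, integral_rpow_mul_exp_neg_mul_gammaMeasure half one_half_pos
      (by positivity) (by positivity), show ν / 2 + (n : ℝ) / 2 = (n + ν) / 2 by ring, scale,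
    marginalConst]
  ring

lemma marginal_pos (hX : IsOrthogonalDesign X) (hν : 0 < ν) (hφ : 0 ≤ φ) (y : Fin n → ℝ)
    (γ : Finset (Fin p)) : 0 < marginal ν (fun _ => φ) X y γ := by
  have := hX.shrunkRSS_nonneg hφ y γ
  have := marginalConst_pos (n := n) hν
  rw [hX.marginal_eq hν hφ]
  positivity

lemma marginal_div (hX : IsOrthogonalDesign X) (hν : 0 < ν) (hφ : 0 ≤ φ) (y : Fin n → ℝ)
    (γ γ₀ : Finset (Fin p)) :
    marginal ν (fun _ => φ) X y γ / marginal ν (fun _ => φ) X y γ₀ =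
      √(1 + n * φ) ^ γ₀.card / √(1 + n * φ) ^ γ.card *
        ((1 + shrunkRSS φ X y γ₀) / (1 + shrunkRSS φ X y γ)) ^ ((n + ν) / 2) := by
  have := hX.shrunkRSS_nonneg hφ y γ
  have := hX.shrunkRSS_nonneg hφ y γ₀
  rw [hX.marginal_eq hν hφ, hX.marginal_eq hν hφ, mul_div_mul_left _ _ (marginalConst_pos hν).ne',
    mul_div_mul_comm, inv_pow, inv_pow, inv_div_inv, Real.rpow_neg (by positivity),
    Real.rpow_neg (by positivity), inv_div_inv, ← Real.div_rpow (by positivity) (by positivity)]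

end IsOrthogonalDesign

end Design

/-! ### Concentration of the noise -/

lemma hasSubgaussianMGF_id_gaussianReal (v : ℝ≥0) :
    HasSubgaussianMGF id v (gaussianReal 0 v) where
  integrable_exp_mul t := integrable_exp_mul_gaussianReal t
  mgf_le t := by simp [mgf_id_gaussianReal]

lemma hasSubgaussianMGF_sum_mul_pi_gaussianReal {ι : Type*} [Fintype ι] (x : ι → ℝ) (v : ℝ≥0) :
    HasSubgaussianMGF (fun e : ι → ℝ => ∑ i, x i * e i) ((∑ i, x i ^ 2).toNNReal * v)
      (Measure.pi fun _ => gaussianReal 0 v) := by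
  have coordinate (i : ι) : HasSubgaussianMGF (id ∘ fun e : ι → ℝ => e i) v
      (Measure.pi fun _ => gaussianReal 0 v) := by
    refine HasSubgaussianMGF.of_map (measurable_pi_apply i).aemeasurable ?_
    rw [(measurePreserving_eval _ i).map_eq]
    exact hasSubgaussianMGF_id_gaussianReal v
  have independent : iIndepFun (fun (i : ι) (e : ι → ℝ) => x i * e i)
      (Measure.pi fun _ => gaussianReal 0 v) :=
    iIndepFun_pi (X := fun i b => x i * b) fun i => by fun_prop
  have scale : (∑ i, x i ^ 2).toNNReal * v = ∑ i, NNReal.mk (x i ^ 2) (sq_nonneg _) * v := by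
    rw [← Finset.sum_mul, Real.toNNReal_sum_of_nonneg fun i _ => sq_nonneg (x i)]
    exact congrArg (· * v) (Finset.sum_congr rfl fun i _ => Real.toNNReal_of_nonneg _)
  rw [scale]
  exact HasSubgaussianMGF.sum_of_iIndepFun independent fun i _ => (coordinate i).const_mul (x i)

lemma measureReal_le_abs_le_of_hasSubgaussianMGF {Ω : Type*} [MeasurableSpace Ω] {μ : Measure Ω}
    {Y : Ω → ℝ} {c : ℝ≥0} {t : ℝ} (hY : HasSubgaussianMGF Y c μ) (ht : 0 ≤ t) :
    μ.real {ω | t ≤ |Y ω|} ≤ 2 * Real.exp (-t ^ 2 / (2 * c)) := by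
  have cover : {ω | t ≤ |Y ω|} = {ω | t ≤ Y ω} ∪ {ω | t ≤ (-Y) ω} := by
    ext ω
    exact le_abs (b := Y ω)
  rw [cover, two_mul]
  exact (measureReal_union_le _ _).trans
    (add_le_add (hY.measure_ge_le ht) (hY.neg.measure_ge_le ht))

lemma measureReal_pi_le_abs_sum_sub_le {ι E : Type*} [Fintype ι] [MeasurableSpace E]
    {μ : Measure E} [IsProbabilityMeasure μ] {f : E → ℝ} {t : ℝ} (hf : MemLp f 2 μ) (ht : 0 < t) :
    (Measure.pi fun _ : ι => μ).real {x | t ≤ |∑ i, f (x i) - Fintype.card ι * μ[f]|} ≤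
      Fintype.card ι * Var[f; μ] / t ^ 2 := by
  have coordinate (i : ι) : MemLp (fun x : ι → E => f (x i)) 2 (Measure.pi fun _ => μ) :=
    hf.comp_measurePreserving (measurePreserving_eval _ i)
  have mean : ∫ x, ∑ i, f (x i) ∂(Measure.pi fun _ : ι => μ) = Fintype.card ι * μ[f] := by
    rw [integral_finsetSum _ fun i _ => (coordinate i).integrable one_le_two]
    simp [integral_comp_eval (μ := fun _ : ι => μ) hf.1]
  have variance : Var[fun x => ∑ i, f (x i); Measure.pi fun _ : ι => μ] =
      Fintype.card ι * Var[f; μ] := by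
    simpa [Finset.sum_fn] using
      variance_sum_pi (μ := fun _ : ι => μ) (X := fun _ => f) fun _ => hf
  have chebyshev := meas_ge_le_variance_div_sq
    (memLp_finsetSum Finset.univ fun i _ => coordinate i) ht
  rw [mean, variance] at chebyshev
  exact ENNReal.toReal_le_of_le_ofReal
    (div_nonneg (mul_nonneg (Nat.cast_nonneg _) (variance_nonneg _ _)) (sq_nonneg _)) chebyshev

lemma integral_sq_gaussianReal (v : ℝ≥0) : ∫ x, x ^ 2 ∂gaussianReal 0 v = v := by
  have h := variance_fun_id_gaussianReal (μ := 0) (v := v)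
  rw [variance_eq_integral measurable_id'.aemeasurable] at h
  simpa using h

lemma memLp_sq_gaussianReal (m : ℝ) (v : ℝ≥0) :
    MemLp (fun x : ℝ => x ^ 2) 2 (gaussianReal m v) := by
  rw [memLp_two_iff_integrable_sq (by fun_prop)]
  have := (memLp_id_gaussianReal' (μ := m) (v := v) 4 (by simp)).integrable_norm_pow four_ne_zero
  refine this.congr (ae_of_all _ fun x => ?_)
  simp [← pow_mul, (show Even 4 by decide).pow_abs]

lemma measure_prodMk_mem_le_of_indepFun {Ω E F : Type*} [MeasurableSpace Ω] [MeasurableSpace E]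
    [MeasurableSpace F] {P : Measure Ω} [IsProbabilityMeasure P] {μ : Measure F} {f : Ω → E}
    {g : Ω → F} {S : Set (E × F)} {C : ℝ≥0∞} (hfg : IndepFun f g P) (hf : AEMeasurable f P)
    (hg : HasLaw g μ P) (hS : MeasurableSet S)
    (hC : ∀ᵐ ω ∂P, μ (Prod.mk (f ω) ⁻¹' S) ≤ C) : P {ω | (f ω, g ω) ∈ S} ≤ C := by
  have : IsProbabilityMeasure μ := hg.map_eq ▸ Measure.isProbabilityMeasure_map hg.aemeasurable
  calc P {ω | (f ω, g ω) ∈ S} = (P.map fun ω => (f ω, g ω)) S :=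
        (Measure.map_apply_of_aemeasurable (hf.prodMk hg.aemeasurable) hS).symm
    _ = ∫⁻ ω, μ (Prod.mk (f ω) ⁻¹' S) ∂P := by
        rw [hfg.map_prod_eq_prod_map_map hf hg.aemeasurable, hg.map_eq, Measure.prod_apply hS,
          lintegral_map' (measurable_measure_prodMk_left hS).aemeasurable hf]
    _ ≤ ∫⁻ _, C ∂P := lintegral_mono_ae hC
    _ = C := by simp

section Noise
variable {n p : ℕ} {X : Matrix (Fin n) (Fin p) ℝ} {δ σ : ℝ}

/-- A level, slightly above `2 σ² log p`, below which the squared projections of a noise vector on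
all the `p` covariates stay with high probability. -/
noncomputable def noiseLevel (δ σ : ℝ) (p : ℕ) : ℝ :=
  2 * (1 + δ) * σ ^ 2 * Real.log p

/-- The event that no covariate is strongly correlated with the noise vector `e`, and that the
squared length of `e` is close to its mean. -/
structure RegularNoise (δ σ : ℝ) (X : Matrix (Fin n) (Fin p) ℝ) (e : Fin n → ℝ) : Prop where
  projSq_le : ∀ j, projSq X e j ≤ noiseLevel δ σ p
  abs_sum_sq_sub_le : |∑ i, e i ^ 2 - n * σ ^ 2| ≤ δ * (n * σ ^ 2)

lemma noiseLevel_nonneg (hδ : 0 ≤ δ) : 0 ≤ noiseLevel δ σ p := by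
  have := Real.log_natCast_nonneg p
  rw [noiseLevel]
  positivity

instance (n : ℕ) (σ2 : ℝ) : IsProbabilityMeasure (noiseLaw n σ2) := by
  rw [noiseLaw]
  infer_instance

lemma IsOrthogonalDesign.sum_sq_col (hX : IsOrthogonalDesign X) (j : Fin p) :
    ∑ i, X i j ^ 2 = n := by
  simpa [Matrix.mul_apply, sq] using congrFun₂ hX j j

lemma IsOrthogonalDesign.noiseLaw_lt_projSq_le (hX : IsOrthogonalDesign X) (hn : 0 < n) {t : ℝ}
    (ht : 0 ≤ t) (j : Fin p) :
    (noiseLaw n (σ ^ 2)).real {e | t < projSq X e j} ≤ 2 * Real.exp (-(t / (2 * σ ^ 2))) := by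
  have large : {e | t < projSq X e j} ⊆ {e : Fin n → ℝ | √(n * t) ≤ |∑ i, X i j * e i|} := by
    intro e he
    refine Real.sqrt_le_iff.2 ⟨abs_nonneg _, ?_⟩
    rw [sq_abs, mul_comm, ← le_div_iff₀ (by positivity)]
    exact le_of_lt he
  have tail := measureReal_le_abs_le_of_hasSubgaussianMGF
    (hasSubgaussianMGF_sum_mul_pi_gaussianReal (fun i => X i j) (σ ^ 2).toNNReal)
    (Real.sqrt_nonneg (n * t))
  refine (measureReal_mono large).trans (tail.trans_eq ?_)
  rw [Real.sq_sqrt (by positivity), hX.sum_sq_col, NNReal.coe_mul,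
    Real.coe_toNNReal _ n.cast_nonneg, Real.coe_toNNReal _ (sq_nonneg σ)]
  field_simp

lemma noiseLaw_lt_abs_sum_sq_sub_le (hδ : 0 < δ) (hσ : 0 < σ) (hn : 0 < n) :
    (noiseLaw n (σ ^ 2)).real {e | δ * (n * σ ^ 2) < |∑ i, e i ^ 2 - n * σ ^ 2|} ≤
      Var[fun x : ℝ => x ^ 2; gaussianReal 0 (σ ^ 2).toNNReal] / (δ * σ ^ 2) ^ 2 / n := by
  have deviation := measureReal_pi_le_abs_sum_sub_le (ι := Fin n)
    (memLp_sq_gaussianReal 0 (σ ^ 2).toNNReal) (t := δ * (n * σ ^ 2)) (by positivity)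
  rw [integral_sq_gaussianReal, Real.coe_toNNReal _ (sq_nonneg σ), Fintype.card_fin] at deviation
  refine (measureReal_mono (Set.ofPred_subset_ofPred.2 fun _ => le_of_lt)).trans
    (deviation.trans_eq ?_)
  field_simp

lemma IsOrthogonalDesign.noiseLaw_not_regularNoise_le (hX : IsOrthogonalDesign X) (hδ : 0 < δ)
    (hσ : 0 < σ) (hn : 0 < n) (hp : 0 < p) :
    (noiseLaw n (σ ^ 2)).real {e | ¬ RegularNoise δ σ X e} ≤ 2 * (p : ℝ) ^ (-δ) +
      Var[fun x : ℝ => x ^ 2; gaussianReal 0 (σ ^ 2).toNNReal] / (δ * σ ^ 2) ^ 2 / n := by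
  have cover : {e | ¬ RegularNoise δ σ X e} ⊆ (⋃ j, {e | noiseLevel δ σ p < projSq X e j}) ∪
      {e | δ * (n * σ ^ 2) < |∑ i, e i ^ 2 - n * σ ^ 2|} := by
    intro e he
    by_contra! hgood
    simp only [Set.mem_union, Set.mem_iUnion, Set.mem_ofPred_eq, not_or, not_exists, not_lt]
      at hgood
    exact he ⟨hgood.1, hgood.2⟩
  have hp' : (0 : ℝ) < p := by exact_mod_cast hp
  have exponent : -(noiseLevel δ σ p / (2 * σ ^ 2)) = Real.log p * (-1) + Real.log p * (-δ) := by
    rw [noiseLevel]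
    field_simp
    ring
  have union_bound : ∑ _j : Fin p, 2 * Real.exp (-(noiseLevel δ σ p / (2 * σ ^ 2))) =
      2 * (p : ℝ) ^ (-δ) := by
    rw [Finset.sum_const, Finset.card_univ, Fintype.card_fin, nsmul_eq_mul, exponent, Real.exp_add,
      ← Real.rpow_def_of_pos hp', ← Real.rpow_def_of_pos hp', Real.rpow_neg_one]
    field_simp
  calc _ ≤ _ := measureReal_mono cover
    _ ≤ _ := measureReal_union_le _ _
    _ ≤ _ := add_le_add ((measureReal_iUnion_fintype_le _).trans (Finset.sum_le_sum fun j _ =>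
        hX.noiseLaw_lt_projSq_le hn (noiseLevel_nonneg hδ.le) j))
        (noiseLaw_lt_abs_sum_sq_sub_le hδ hσ hn)
    _ = _ := by rw [union_bound]

lemma measurableSet_regularNoise (δ σ : ℝ) :
    MeasurableSet {q : (Fin n → Fin p → ℝ) × (Fin n → ℝ) |
      RegularNoise δ σ (Matrix.of q.1) q.2} := by
  have : {q : (Fin n → Fin p → ℝ) × (Fin n → ℝ) | RegularNoise δ σ (Matrix.of q.1) q.2} =
      (⋂ j, {q | (∑ i, q.1 i j * q.2 i) ^ 2 / n ≤ noiseLevel δ σ p}) ∩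
        {q | |∑ i, q.2 i ^ 2 - n * σ ^ 2| ≤ δ * (n * σ ^ 2)} := by
    ext q
    simp only [Set.mem_inter_iff, Set.mem_iInter]
    exact ⟨fun h => ⟨h.projSq_le, h.abs_sum_sq_sub_le⟩, fun h => ⟨h.1, h.2⟩⟩
  rw [this]
  exact (MeasurableSet.iInter fun j => measurableSet_le (by fun_prop) measurable_const).inter
    (measurableSet_le (by fun_prop) measurable_const)

end Noise

lemma tendsto_measure_not_regularNoise {Ω : Type*} [MeasurableSpace Ω] {P : Measure Ω}
    [IsProbabilityMeasure P] {p : ℕ → ℕ} {X : ∀ n, Ω → Matrix (Fin n) (Fin (p n)) ℝ}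
    {ε : ∀ n, Ω → Fin n → ℝ} {δ σ : ℝ} (hδ : 0 < δ) (hσ : 0 < σ)
    (hX : ∀ n, Measurable fun ω => (fun i j => X n ω i j : Fin n → Fin (p n) → ℝ))
    (hε : ∀ n, HasLaw (ε n) (noiseLaw n (σ ^ 2)) P)
    (hind : ∀ n, IndepFun (fun ω => (fun i j => X n ω i j : Fin n → Fin (p n) → ℝ)) (ε n) P)
    (hXX : ∀ n, ∀ᵐ ω ∂P, IsOrthogonalDesign (X n ω)) (hp : Tendsto p atTop atTop) :
    Tendsto (fun n => P {ω | ¬ RegularNoise δ σ (X n ω) (ε n ω)}) atTop (𝓝 0) := by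
  set V := Var[fun x : ℝ => x ^ 2; gaussianReal 0 (σ ^ 2).toNNReal] / (δ * σ ^ 2) ^ 2
  have bound_tendsto : Tendsto (fun n => ENNReal.ofReal (2 * (p n : ℝ) ^ (-δ) + V / n)) atTop
      (𝓝 0) := by
    have h := (((tendsto_rpow_neg_atTop hδ).comp (tendsto_natCast_atTop_atTop.comp hp)).const_mul
      2).add (tendsto_const_div_atTop_nhds_zero_nat V)
    simpa using ENNReal.tendsto_ofReal h
  refine tendsto_of_tendsto_of_tendsto_of_le_of_le' tendsto_const_nhds bound_tendsto
    (Eventually.of_forall fun _ => zero_le) ?_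
  filter_upwards [eventually_gt_atTop 0, hp.eventually_gt_atTop 0] with n hn hpn
  refine measure_prodMk_mem_le_of_indepFun (hind n) (hX n).aemeasurable (hε n)
    (measurableSet_regularNoise δ σ).compl ?_
  filter_upwards [hXX n] with ω hω
  have bound := hω.noiseLaw_not_regularNoise_le hδ hσ hn hpn
  exact (ENNReal.le_ofReal_iff_toReal_le (measure_ne_top _ _) (measureReal_nonneg.trans bound)).2
    bound

/-! ### Comparison of residual sums of squares -/

section Response
variable {n p : ℕ} {X : Matrix (Fin n) (Fin p) ℝ} {β : Fin p → ℝ} {e : Fin n → ℝ} {δ σ φ a : ℝ}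

lemma mem_supp {j : Fin p} : j ∈ supp β ↔ β j ≠ 0 := by
  simp [supp]

lemma energy_nonneg (β : Fin p → ℝ) : 0 ≤ energy β :=
  Finset.sum_nonneg fun j _ => sq_nonneg (β j)

lemma one_sub_shrinkage (hφ : 0 ≤ φ) : 1 - shrinkage n φ = (1 + n * φ)⁻¹ := by
  rw [shrinkage]
  field_simp
  ring

lemma sq_mul_scaleA (hn : 0 < n) (hσ : 0 < σ) (hφ : 0 ≤ φ) (k : ℝ) :
    σ ^ 2 * scaleA σ n k φ = n * σ ^ 2 + (1 - shrinkage n φ) * (n * k) := by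
  rw [one_sub_shrinkage hφ, scaleA]
  field_simp

lemma natCast_le_scaleA {k : ℝ} (hk : 0 ≤ k) (hφ : 0 ≤ φ) : (n : ℝ) ≤ scaleA σ n k φ := by
  rw [scaleA]
  have : 0 ≤ (σ ^ 2)⁻¹ * k / ((n : ℝ)⁻¹ + φ) := by positivity
  linarith

namespace IsOrthogonalDesign

lemma projSq_response (hX : IsOrthogonalDesign X) (hn : 0 < n) (β : Fin p → ℝ) (e : Fin n → ℝ)
    (j : Fin p) : projSq X (X *ᵥ β + e) j =
      n * β j ^ 2 + 2 * β j * (Xᵀ *ᵥ e) j + projSq X e j := by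
  simp only [projSq, Matrix.mulVec_add, hX.transpose_mulVec_mulVec, Pi.add_apply, Pi.smul_apply,
    smul_eq_mul]
  field_simp
  ring

lemma projSq_response_of_notMem (hX : IsOrthogonalDesign X) (hn : 0 < n) {j : Fin p}
    (hj : j ∉ supp β) : projSq X (X *ᵥ β + e) j = projSq X e j := by
  rw [hX.projSq_response hn, not_not.1 (mem_supp.not.1 hj)]
  ring

lemma abs_projSq_response_sub_le (hX : IsOrthogonalDesign X) (hn : 0 < n) (hδ : 0 < δ)
    (j : Fin p) : |projSq X (X *ᵥ β + e) j - n * β j ^ 2| ≤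
      δ * (n * β j ^ 2) + (1 + δ⁻¹) * projSq X e j := by
  have young : |2 * β j * (Xᵀ *ᵥ e) j| ≤ δ * (n * β j ^ 2) + δ⁻¹ * projSq X e j := by
    have : (0 : ℝ) < n := by exact_mod_cast hn
    have plus : 0 ≤ (δ * n * β j + (Xᵀ *ᵥ e) j) ^ 2 / (δ * n) := by positivity
    have minus : 0 ≤ (δ * n * β j - (Xᵀ *ᵥ e) j) ^ 2 / (δ * n) := by positivity
    have plus_eq : (δ * n * β j + (Xᵀ *ᵥ e) j) ^ 2 / (δ * n) =
        δ * (n * β j ^ 2) + δ⁻¹ * projSq X e j + 2 * β j * (Xᵀ *ᵥ e) j := by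
      rw [projSq]
      field_simp
      ring
    have minus_eq : (δ * n * β j - (Xᵀ *ᵥ e) j) ^ 2 / (δ * n) =
        δ * (n * β j ^ 2) + δ⁻¹ * projSq X e j - 2 * β j * (Xᵀ *ᵥ e) j := by
      rw [projSq]
      field_simp
      ring
    exact abs_le.2 ⟨by linarith, by linarith⟩
  have hg := projSq_nonneg X e j
  rw [hX.projSq_response hn]
  calc |n * β j ^ 2 + 2 * β j * (Xᵀ *ᵥ e) j + projSq X e j - n * β j ^ 2|
      = |2 * β j * (Xᵀ *ᵥ e) j + projSq X e j| := by ring_nf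
    _ ≤ |2 * β j * (Xᵀ *ᵥ e) j| + projSq X e j :=
        (abs_add_le _ _).trans_eq (by rw [abs_of_nonneg hg])
    _ ≤ δ * (n * β j ^ 2) + (1 + δ⁻¹) * projSq X e j := by linarith

lemma sum_sq_response (hX : IsOrthogonalDesign X) (hn : 0 < n) (β : Fin p → ℝ)
    (e : Fin n → ℝ) : ∑ i, (X *ᵥ β + e) i ^ 2 =
      ∑ i, e i ^ 2 + ∑ j ∈ supp β, (projSq X (X *ᵥ β + e) j - projSq X e j) := by
  have residual := hX.sum_sub_mulVec_sq (X *ᵥ β + e) β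
  have fit (j : Fin p) : 2 * β j * (Xᵀ *ᵥ (X *ᵥ β + e)) j - n * β j ^ 2 =
      projSq X (X *ᵥ β + e) j - projSq X e j := by
    simp only [hX.projSq_response hn, Matrix.mulVec_add, hX.transpose_mulVec_mulVec, Pi.add_apply,
      Pi.smul_apply, smul_eq_mul]
    ring
  simp only [fit, Pi.add_apply, add_sub_cancel_left] at residual
  rw [Finset.sum_subset (Finset.subset_univ (supp β)) fun j _ hj =>
    sub_eq_zero.2 (hX.projSq_response_of_notMem hn hj)]
  simp only [Pi.add_apply]
  linarith

lemma shrunkRSS_supp (hX : IsOrthogonalDesign X) (hn : 0 < n) (φ : ℝ) (β : Fin p → ℝ)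
    (e : Fin n → ℝ) : shrunkRSS φ X (X *ᵥ β + e) (supp β) =
      ∑ i, e i ^ 2 + (1 - shrinkage n φ) * ∑ j ∈ supp β, projSq X (X *ᵥ β + e) j -
        ∑ j ∈ supp β, projSq X e j := by
  rw [shrunkRSS, hX.sum_sq_response hn, Finset.sum_sub_distrib]
  ring

lemma shrunkRSS_sub_shrunkRSS_supp (hX : IsOrthogonalDesign X) (hn : 0 < n) (φ : ℝ)
    (β : Fin p → ℝ) (e : Fin n → ℝ) (γ : Finset (Fin p)) :
    shrunkRSS φ X (X *ᵥ β + e) γ - shrunkRSS φ X (X *ᵥ β + e) (supp β) =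
      shrinkage n φ * ∑ j ∈ supp β \ γ, projSq X (X *ᵥ β + e) j -
        shrinkage n φ * ∑ j ∈ γ \ supp β, projSq X e j := by
  have off_support : ∑ j ∈ γ \ supp β, projSq X (X *ᵥ β + e) j =
      ∑ j ∈ γ \ supp β, projSq X e j :=
    Finset.sum_congr rfl fun j hj =>
      hX.projSq_response_of_notMem hn (Finset.mem_sdiff.1 hj).2
  rw [← mul_sub, ← off_support, Finset.sum_sdiff_sub_sum_sdiff, shrunkRSS, shrunkRSS]
  ring

end IsOrthogonalDesign

lemma RegularNoise.sum_projSq_le (he : RegularNoise δ σ X e) (s : Finset (Fin p)) :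
    ∑ j ∈ s, projSq X e j ≤ s.card * noiseLevel δ σ p := by
  simpa using Finset.sum_le_card_nsmul s _ _ fun j _ => he.projSq_le j

/-- The deterministic conditions, met by all large samples, under which regular noise does not upset
the comparison of residual sums of squares: relative to the scale `σ² a` of the residual sum of
squares of the true model, the total noise level of all covariates and the constant `1` are at most
of the small proportion `δ`. -/
structure IsLargeSample (n : ℕ) (β : Fin p → ℝ) (δ σ φ a : ℝ) : Prop where
  n_pos : 0 < n
  φ_pos : 0 < φ
  σ_pos : 0 < σ
  δ_pos : 0 < δ
  δ_le : δ ≤ 1 / 4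
  a_eq : a = scaleA σ n (energy β) φ
  noise_le : (2 + δ⁻¹) * (p * noiseLevel δ σ p) ≤ δ * (σ ^ 2 * a)
  one_le : 1 ≤ δ * (σ ^ 2 * a)
  shrinkage_ge : 1 - δ ≤ shrinkage n φ

namespace IsLargeSample

lemma a_pos (h : IsLargeSample n β δ σ φ a) : 0 < a := by
  have : (0 : ℝ) < n := by exact_mod_cast h.n_pos
  exact this.trans_le (h.a_eq ▸ natCast_le_scaleA (energy_nonneg β) h.φ_pos.le)

lemma noiseLevel_nonneg (h : IsLargeSample n β δ σ φ a) : 0 ≤ noiseLevel δ σ p :=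
  BVS.noiseLevel_nonneg h.δ_pos.le

lemma card_mul_noiseLevel_le (h : IsLargeSample n β δ σ φ a) (s : Finset (Fin p)) :
    s.card * noiseLevel δ σ p ≤ p * noiseLevel δ σ p :=
  mul_le_mul_of_nonneg_right (by exact_mod_cast card_finset_fin_le s) h.noiseLevel_nonneg

lemma scale_eq (h : IsLargeSample n β δ σ φ a) :
    σ ^ 2 * a = n * σ ^ 2 + (1 - shrinkage n φ) * ∑ j ∈ supp β, n * β j ^ 2 := by
  rw [h.a_eq, sq_mul_scaleA h.n_pos h.σ_pos h.φ_pos.le, energy, ← Finset.mul_sum]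

lemma shrunkRSS_supp_sub_scale (h : IsLargeSample n β δ σ φ a) (hX : IsOrthogonalDesign X)
    (e : Fin n → ℝ) :
    shrunkRSS φ X (X *ᵥ β + e) (supp β) - σ ^ 2 * a = (∑ i, e i ^ 2 - n * σ ^ 2) +
      (1 - shrinkage n φ) * ∑ j ∈ supp β, (projSq X (X *ᵥ β + e) j - n * β j ^ 2) -
        ∑ j ∈ supp β, projSq X e j := by
  rw [hX.shrunkRSS_supp h.n_pos, h.scale_eq, Finset.sum_sub_distrib]
  ring

lemma abs_sum_projSq_response_sub_le (h : IsLargeSample n β δ σ φ a) (hX : IsOrthogonalDesign X)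
    (e : Fin n → ℝ) :
    |∑ j ∈ supp β, (projSq X (X *ᵥ β + e) j - n * β j ^ 2)| ≤
      δ * ∑ j ∈ supp β, n * β j ^ 2 + (1 + δ⁻¹) * ∑ j ∈ supp β, projSq X e j := by
  rw [Finset.mul_sum, Finset.mul_sum, ← Finset.sum_add_distrib]
  exact (Finset.abs_sum_le_sum_abs _ _).trans
    (Finset.sum_le_sum fun j _ => hX.abs_projSq_response_sub_le h.n_pos h.δ_pos j)

lemma abs_shrunkRSS_supp_sub_le (h : IsLargeSample n β δ σ φ a) (hX : IsOrthogonalDesign X)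
    (he : RegularNoise δ σ X e) :
    |shrunkRSS φ X (X *ᵥ β + e) (supp β) - σ ^ 2 * a| ≤ 2 * δ * (σ ^ 2 * a) := by
  have hδ := inv_pos.2 h.δ_pos
  have hlam : 0 ≤ 1 - shrinkage n φ := sub_nonneg.2 (shrinkage_le_one h.φ_pos.le)
  have hlam' : 1 - shrinkage n φ ≤ 1 := by linarith [shrinkage_nonneg (n := n) h.φ_pos.le]
  set G := ∑ j ∈ supp β, projSq X e j
  have hG0 : 0 ≤ G := Finset.sum_nonneg fun j _ => projSq_nonneg X e j
  have noise : (2 + δ⁻¹) * G ≤ δ * (σ ^ 2 * a) :=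
    (mul_le_mul_of_nonneg_left ((he.sum_projSq_le _).trans (h.card_mul_noiseLevel_le _))
      (by positivity)).trans h.noise_le
  calc |shrunkRSS φ X (X *ᵥ β + e) (supp β) - σ ^ 2 * a|
      ≤ |∑ i, e i ^ 2 - n * σ ^ 2| + (1 - shrinkage n φ) *
          |∑ j ∈ supp β, (projSq X (X *ᵥ β + e) j - n * β j ^ 2)| + G := by
        rw [h.shrunkRSS_supp_sub_scale hX]
        refine (abs_sub _ _).trans (add_le_add ((abs_add_le _ _).trans_eq ?_) ?_)
        · rw [abs_mul, abs_of_nonneg hlam]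
        · rw [abs_of_nonneg hG0]
    _ ≤ δ * (n * σ ^ 2) + (1 - shrinkage n φ) *
          (δ * ∑ j ∈ supp β, n * β j ^ 2 + (1 + δ⁻¹) * G) + G := by
        gcongr
        · exact he.abs_sum_sq_sub_le
        · exact h.abs_sum_projSq_response_sub_le hX e
    _ = δ * (σ ^ 2 * a) + ((1 - shrinkage n φ) * ((1 + δ⁻¹) * G) + G) := by
        rw [h.scale_eq]
        ring
    _ ≤ δ * (σ ^ 2 * a) + (1 * ((1 + δ⁻¹) * G) + G) := by gcongr
    _ ≤ 2 * δ * (σ ^ 2 * a) := by linarith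

lemma shrunkRSS_supp_add_sub_le (h : IsLargeSample n β δ σ φ a) (hX : IsOrthogonalDesign X)
    (he : RegularNoise δ σ X e) (γ : Finset (Fin p)) :
    shrunkRSS φ X (X *ᵥ β + e) (supp β) +
        shrinkage n φ * ∑ j ∈ supp β \ γ, projSq X (X *ᵥ β + e) j -
          (γ \ supp β).card * noiseLevel δ σ p ≤
      shrunkRSS φ X (X *ᵥ β + e) γ := by
  have overfit : shrinkage n φ * ∑ j ∈ γ \ supp β, projSq X e j ≤
      (γ \ supp β).card * noiseLevel δ σ p :=
    (mul_le_of_le_one_left (Finset.sum_nonneg fun j _ => projSq_nonneg X e j)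
      (shrinkage_le_one h.φ_pos.le)).trans (he.sum_projSq_le _)
  linarith [hX.shrunkRSS_sub_shrunkRSS_supp h.n_pos φ β e γ]

lemma shrunkRSS_supp_sub_le (h : IsLargeSample n β δ σ φ a) (hX : IsOrthogonalDesign X)
    (he : RegularNoise δ σ X e) (γ : Finset (Fin p)) :
    shrunkRSS φ X (X *ᵥ β + e) (supp β) - shrunkRSS φ X (X *ᵥ β + e) γ ≤
      (γ \ supp β).card * noiseLevel δ σ p := by
  have gain : 0 ≤ shrinkage n φ * ∑ j ∈ supp β \ γ, projSq X (X *ᵥ β + e) j :=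
    mul_nonneg (shrinkage_nonneg h.φ_pos.le)
      (Finset.sum_nonneg fun j _ => projSq_nonneg X _ j)
  linarith [h.shrunkRSS_supp_add_sub_le hX he γ]

lemma card_mul_noiseLevel_le_mul_scale (h : IsLargeSample n β δ σ φ a) (s : Finset (Fin p)) :
    s.card * noiseLevel δ σ p ≤ δ * (σ ^ 2 * a) := by
  have : 0 ≤ p * noiseLevel δ σ p := mul_nonneg p.cast_nonneg h.noiseLevel_nonneg
  have hδ := inv_pos.2 h.δ_pos
  nlinarith [h.card_mul_noiseLevel_le s, h.noise_le]

lemma mul_scale_le_shrunkRSS (h : IsLargeSample n β δ σ φ a) (hX : IsOrthogonalDesign X)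
    (he : RegularNoise δ σ X e) (γ : Finset (Fin p)) :
    (1 - 3 * δ) * (σ ^ 2 * a) ≤ shrunkRSS φ X (X *ᵥ β + e) γ := by
  linarith [(abs_le.1 (h.abs_shrunkRSS_supp_sub_le hX he)).1, h.shrunkRSS_supp_sub_le hX he γ,
    h.card_mul_noiseLevel_le_mul_scale (γ \ supp β)]

lemma one_add_shrunkRSS_supp_le (h : IsLargeSample n β δ σ φ a) (hX : IsOrthogonalDesign X)
    (he : RegularNoise δ σ X e) :
    1 + shrunkRSS φ X (X *ᵥ β + e) (supp β) ≤ (1 + 3 * δ) * (σ ^ 2 * a) := by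
  linarith [(abs_le.1 (h.abs_shrunkRSS_supp_sub_le hX he)).2, h.one_le]

lemma one_add_shrunkRSS_div_le_exp (h : IsLargeSample n β δ σ φ a) (hX : IsOrthogonalDesign X)
    (he : RegularNoise δ σ X e) {α₀ : ℝ} (hα : 2 * (1 + δ) ≤ α₀ * (1 - 3 * δ))
    (γ : Finset (Fin p)) :
    (1 + shrunkRSS φ X (X *ᵥ β + e) (supp β)) / (1 + shrunkRSS φ X (X *ᵥ β + e) γ) ≤
      Real.exp (α₀ * Real.log p / a * (γ \ supp β).card) := by
  have ha := h.a_pos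
  have hσ := h.σ_pos
  have hδ : 0 < 1 - 3 * δ := by linarith [h.δ_le]
  have hR := hX.shrunkRSS_nonneg h.φ_pos.le (X *ᵥ β + e) γ
  have overfit := h.shrunkRSS_supp_sub_le hX he γ
  set b := ((γ \ supp β).card : ℝ)
  have relative_noise : b * noiseLevel δ σ p ≤
      α₀ * Real.log p / a * b * ((1 - 3 * δ) * (σ ^ 2 * a)) := by
    have : 0 ≤ b * σ ^ 2 * Real.log p := by
      have := Real.log_natCast_nonneg p
      positivity
    calc b * noiseLevel δ σ p = 2 * (1 + δ) * (b * σ ^ 2 * Real.log p) := by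
          rw [noiseLevel]
          ring
      _ ≤ α₀ * (1 - 3 * δ) * (b * σ ^ 2 * Real.log p) := mul_le_mul_of_nonneg_right hα this
      _ = α₀ * Real.log p / a * b * ((1 - 3 * δ) * (σ ^ 2 * a)) := by
          field_simp
  have hx : 0 ≤ α₀ * Real.log p / a * b := by
    have : 0 < α₀ := by
      refine pos_of_mul_pos_left ?_ hδ.le
      linarith [h.δ_pos]
    have := Real.log_natCast_nonneg p
    positivity
  rw [div_le_iff₀ (by positivity)]
  calc 1 + shrunkRSS φ X (X *ᵥ β + e) (supp β)
      ≤ (α₀ * Real.log p / a * b + 1) * (1 + shrunkRSS φ X (X *ᵥ β + e) γ) := by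
        nlinarith [mul_le_mul_of_nonneg_left (h.mul_scale_le_shrunkRSS hX he γ) hx]
    _ ≤ Real.exp (α₀ * Real.log p / a * b) * (1 + shrunkRSS φ X (X *ᵥ β + e) γ) :=
        mul_le_mul_of_nonneg_right (Real.add_one_le_exp _) (by positivity)

lemma mul_sq_le_shrunkRSS_of_notMem (h : IsLargeSample n β δ σ φ a) (hX : IsOrthogonalDesign X)
    (he : RegularNoise δ σ X e) {γ : Finset (Fin p)} {j : Fin p} (hj : j ∈ supp β)
    (hjγ : j ∉ γ) :
    (1 - δ) ^ 2 * (n * β j ^ 2) ≤ shrunkRSS φ X (X *ᵥ β + e) γ := by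
  have hδ := inv_pos.2 h.δ_pos
  have hδ1 : 0 ≤ 1 - δ := by linarith [h.δ_le]
  have hM := h.noiseLevel_nonneg
  have signal : (1 - δ) * (n * β j ^ 2) - (1 + δ⁻¹) * noiseLevel δ σ p ≤
      projSq X (X *ᵥ β + e) j := by
    have := mul_le_mul_of_nonneg_left (he.projSq_le j) (by positivity : 0 ≤ 1 + δ⁻¹)
    linarith [(abs_le.1 (hX.abs_projSq_response_sub_le (β := β) (e := e) h.n_pos h.δ_pos j)).1]
  have gain : (1 - δ) * projSq X (X *ᵥ β + e) j ≤
      shrinkage n φ * ∑ j ∈ supp β \ γ, projSq X (X *ᵥ β + e) j :=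
    mul_le_mul h.shrinkage_ge
      (Finset.single_le_sum (f := projSq X (X *ᵥ β + e)) (fun j _ => projSq_nonneg X _ j)
        (Finset.mem_sdiff.2 ⟨hj, hjγ⟩))
      (projSq_nonneg X _ j) (shrinkage_nonneg h.φ_pos.le)
  have noise : (1 + δ⁻¹) * noiseLevel δ σ p + (γ \ supp β).card * noiseLevel δ σ p ≤
      δ * (σ ^ 2 * a) := by
    have one_le_p : (1 : ℝ) ≤ p := by exact_mod_cast Fin.pos j
    have : noiseLevel δ σ p ≤ p * noiseLevel δ σ p := le_mul_of_one_le_left hM one_le_p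
    nlinarith [h.noise_le, h.card_mul_noiseLevel_le (γ \ supp β)]
  have scale_nonneg : 0 ≤ (1 - 3 * δ) * (σ ^ 2 * a) :=
    mul_nonneg (by linarith [h.δ_le]) (mul_nonneg (sq_nonneg σ) h.a_pos.le)
  have shrunk_noise : (1 - δ) * ((1 + δ⁻¹) * noiseLevel δ σ p) ≤
      (1 + δ⁻¹) * noiseLevel δ σ p :=
    mul_le_of_le_one_left (by positivity) (by linarith [h.δ_pos])
  linarith [mul_le_mul_of_nonneg_left signal hδ1, h.shrunkRSS_supp_add_sub_le hX he γ,
    (abs_le.1 (h.abs_shrunkRSS_supp_sub_le hX he)).1]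

lemma mul_one_add_shrunkRSS_supp_le (h : IsLargeSample n β δ σ φ a) (hX : IsOrthogonalDesign X)
    (he : RegularNoise δ σ X e) {t ψ : ℝ} (ht : 0 ≤ t) (hψ : 0 ≤ ψ)
    (hβ : ∀ j ∈ supp β, ψ ≤ |β j|)
    (htψ : t * ((1 + 3 * δ) * (σ ^ 2 * a)) ≤ (1 - δ) ^ 2 * (n * ψ ^ 2))
    {γ : Finset (Fin p)} (hγ : ¬ supp β ⊆ γ) :
    t * (1 + shrunkRSS φ X (X *ᵥ β + e) (supp β)) ≤ 1 + shrunkRSS φ X (X *ᵥ β + e) γ := by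
  obtain ⟨j, hj, hjγ⟩ := Finset.not_subset.1 hγ
  calc t * (1 + shrunkRSS φ X (X *ᵥ β + e) (supp β)) ≤ t * ((1 + 3 * δ) * (σ ^ 2 * a)) :=
        mul_le_mul_of_nonneg_left (h.one_add_shrunkRSS_supp_le hX he) ht
    _ ≤ (1 - δ) ^ 2 * (n * ψ ^ 2) := htψ
    _ ≤ (1 - δ) ^ 2 * (n * β j ^ 2) := by
        rw [← sq_abs (β j)]
        gcongr
        exact hβ j hj
    _ ≤ shrunkRSS φ X (X *ᵥ β + e) γ := h.mul_sq_le_shrunkRSS_of_notMem hX he hj hjγ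
    _ ≤ 1 + shrunkRSS φ X (X *ᵥ β + e) γ := by linarith

end IsLargeSample

end Response

/-! ### Posterior odds -/

section Posterior
variable {n p : ℕ} {ν : ℝ} {c : Fin p → ℝ} {w : Finset (Fin p) → ℝ}
  {X : Matrix (Fin n) (Fin p) ℝ} {y : Fin n → ℝ} {γ₀ : Finset (Fin p)}

lemma evidence_pos (hm : ∀ γ, 0 < marginal ν c X y γ) (hw : ∀ γ, 0 ≤ w γ) (hw₀ : 0 < w γ₀) :
    0 < ∑ γ, w γ * marginal ν c X y γ :=
  Finset.sum_pos' (fun γ _ => mul_nonneg (hw γ) (hm γ).le)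
    ⟨γ₀, Finset.mem_univ _, mul_pos hw₀ (hm γ₀)⟩

lemma posterior_nonneg (hm : ∀ γ, 0 < marginal ν c X y γ) (hw : ∀ γ, 0 ≤ w γ)
    (γ : Finset (Fin p)) : 0 ≤ posterior ν c w X y γ :=
  div_nonneg (mul_nonneg (hw γ) (hm γ).le)
    (Finset.sum_nonneg fun γ' _ => mul_nonneg (hw γ') (hm γ').le)

lemma sum_posterior (hm : ∀ γ, 0 < marginal ν c X y γ) (hw : ∀ γ, 0 ≤ w γ) (hw₀ : 0 < w γ₀) :
    ∑ γ, posterior ν c w X y γ = 1 := by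
  simp_rw [posterior, ← Finset.sum_div]
  exact div_self (evidence_pos hm hw hw₀).ne'

/-- The posterior odds `p(γ | y, X) / p(γ₀ | y, X)` of the model `γ` against `γ₀`. -/
noncomputable def posteriorOdds (ν : ℝ) (c : Fin p → ℝ) (w : Finset (Fin p) → ℝ)
    (X : Matrix (Fin n) (Fin p) ℝ) (y : Fin n → ℝ) (γ₀ γ : Finset (Fin p)) : ℝ :=
  posterior ν c w X y γ / posterior ν c w X y γ₀

lemma posteriorOdds_nonneg (hm : ∀ γ, 0 < marginal ν c X y γ) (hw : ∀ γ, 0 ≤ w γ)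
    (γ₀ γ : Finset (Fin p)) : 0 ≤ posteriorOdds ν c w X y γ₀ γ :=
  div_nonneg (posterior_nonneg hm hw γ) (posterior_nonneg hm hw γ₀)

lemma maxOdds_nonneg (hm : ∀ γ, 0 < marginal ν c X y γ) (hw : ∀ γ, 0 ≤ w γ)
    (γ₀ : Finset (Fin p)) : 0 ≤ maxOdds ν c w X y γ₀ :=
  Real.iSup_nonneg fun γ => posteriorOdds_nonneg hm hw γ₀ γ.1

lemma posteriorOdds_eq_mul (hm : ∀ γ, 0 < marginal ν c X y γ) (hw : ∀ γ, 0 ≤ w γ)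
    (hw₀ : 0 < w γ₀) (γ : Finset (Fin p)) : posteriorOdds ν c w X y γ₀ γ =
      w γ / w γ₀ * (marginal ν c X y γ / marginal ν c X y γ₀) := by
  rw [posteriorOdds, posterior, posterior,
    div_div_div_cancel_right₀ (evidence_pos hm hw hw₀).ne', mul_div_mul_comm]

lemma posterior_le_posteriorOdds (hm : ∀ γ, 0 < marginal ν c X y γ) (hw : ∀ γ, 0 ≤ w γ)
    (hw₀ : 0 < w γ₀) (γ : Finset (Fin p)) :
    posterior ν c w X y γ ≤ posteriorOdds ν c w X y γ₀ γ := by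
  have pos : 0 < posterior ν c w X y γ₀ :=
    div_pos (mul_pos hw₀ (hm γ₀)) (evidence_pos hm hw hw₀)
  have le_one : posterior ν c w X y γ₀ ≤ 1 := by
    rw [← sum_posterior hm hw hw₀]
    exact Finset.single_le_sum (fun γ _ => posterior_nonneg hm hw γ) (Finset.mem_univ γ₀)
  exact le_div_self (posterior_nonneg hm hw γ) pos le_one

lemma nonneg_of_forall_div_le {C : ℝ} (hw₀ : 0 < w γ₀) (hC : ∀ γ, w γ / w γ₀ ≤ C) : 0 ≤ C :=
  zero_le_one.trans (div_self hw₀.ne' ▸ hC γ₀)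

lemma posteriorOdds_le {C b : ℝ} (hm : ∀ γ, 0 < marginal ν c X y γ) (hw : ∀ γ, 0 ≤ w γ)
    (hw₀ : 0 < w γ₀) (hC : ∀ γ, w γ / w γ₀ ≤ C) {γ : Finset (Fin p)}
    (hb : marginal ν c X y γ / marginal ν c X y γ₀ ≤ b) :
    posteriorOdds ν c w X y γ₀ γ ≤ C * b := by
  rw [posteriorOdds_eq_mul hm hw hw₀]
  exact mul_le_mul (hC γ) hb (div_pos (hm γ) (hm γ₀)).le (nonneg_of_forall_div_le hw₀ hC)

lemma sum_erase_posterior (hm : ∀ γ, 0 < marginal ν c X y γ) (hw : ∀ γ, 0 ≤ w γ)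
    (hw₀ : 0 < w γ₀) :
    ∑ γ ∈ Finset.univ.erase γ₀, posterior ν c w X y γ = 1 - posterior ν c w X y γ₀ := by
  rw [Finset.sum_erase_eq_sub (Finset.mem_univ γ₀), sum_posterior hm hw hw₀]

end Posterior

section OddsBounds
variable {ι : Type*} [DecidableEq ι] {f : Finset ι → ℝ} {s : Finset ι} {C r u u' : ℝ}

/-- Bounds, up to the factor `C`, on the odds `f` of the models against the model `s`: a factor `r`
for every covariate added to `s`, and the bound `u` for a model omitting a covariate of `s`. -/
structure HasOddsBounds (f : Finset ι → ℝ) (s : Finset ι) (C r u : ℝ) : Prop where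
  le_of_subset : ∀ γ, s ⊆ γ → f γ ≤ C * r ^ (γ \ s).card
  le_of_not_subset : ∀ γ, ¬ s ⊆ γ → f γ ≤ C * u

lemma sum_superset_pow_card_sdiff [Fintype ι] (s : Finset ι) (r : ℝ) :
    ∑ γ with s ⊆ γ, r ^ (γ \ s).card = (1 + r) ^ sᶜ.card := by
  have added {t : Finset ι} (ht : t ∈ sᶜ.powerset) : (s ∪ t) \ s = t :=
    Finset.union_sdiff_cancel_left
      (Finset.subset_compl_iff_disjoint_left.1 (Finset.mem_powerset.1 ht))
  have supersets : Finset.univ.filter (s ⊆ ·) = sᶜ.powerset.image (s ∪ ·) := by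
    rw [Finset.compl_eq_univ_sdiff, ← Finset.Icc_eq_image_powerset (Finset.subset_univ s)]
    ext γ
    simp
  calc ∑ γ with s ⊆ γ, r ^ (γ \ s).card = ∑ t ∈ sᶜ.powerset, r ^ ((s ∪ t) \ s).card := by
        rw [supersets, Finset.sum_image fun t ht t' ht' h => by
          rw [← added ht, ← added ht']
          exact congrArg (· \ s) h]
    _ = ∑ t ∈ sᶜ.powerset, r ^ t.card * 1 ^ (sᶜ.card - t.card) :=
        Finset.sum_congr rfl fun t ht => by rw [added ht, one_pow, mul_one]
    _ = (1 + r) ^ sᶜ.card := by rw [Finset.sum_pow_mul_eq_add_pow, add_comm]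

namespace HasOddsBounds

lemma mono_right (h : HasOddsBounds f s C r u) (hC : 0 ≤ C) (hu : s.Nonempty → u ≤ u') :
    HasOddsBounds f s C r u' where
  le_of_subset := h.le_of_subset
  le_of_not_subset γ hγ := by
    have hs : s.Nonempty := Finset.nonempty_iff_ne_empty.2 fun h0 => hγ (h0 ▸ γ.empty_subset)
    exact (h.le_of_not_subset γ hγ).trans (mul_le_mul_of_nonneg_left (hu hs) hC)

lemma iSup_le (h : HasOddsBounds f s C r u) (hC : 0 ≤ C) (hr : 0 ≤ r) (hr1 : r ≤ 1)
    (hu : 0 ≤ u) : ⨆ γ : {γ // γ ≠ s}, f γ ≤ C * (r + u) := by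
  refine Real.iSup_le (fun γ => ?_) (by positivity)
  by_cases hγ : s ⊆ γ
  · have hcard : (γ.1 \ s).card ≠ 0 :=
      Finset.card_ne_zero.2 (Finset.sdiff_nonempty.2 fun hsub => γ.2 (hsub.antisymm hγ))
    refine (h.le_of_subset _ hγ).trans (mul_le_mul_of_nonneg_left ?_ hC)
    exact (pow_le_of_le_one hr hr1 hcard).trans (le_add_of_nonneg_right hu)
  · exact (h.le_of_not_subset _ hγ).trans
      (mul_le_mul_of_nonneg_left (le_add_of_nonneg_left hr) hC)

lemma sum_erase_le [Fintype ι] (h : HasOddsBounds f s C r u) (hC : 0 ≤ C) (hr : 0 ≤ r)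
    (hu : 0 ≤ u) : ∑ γ ∈ Finset.univ.erase s, f γ ≤
      C * ((1 + r) ^ Fintype.card ι - 1 + 2 ^ Fintype.card ι * u) := by
  have pointwise (γ : Finset ι) : f γ ≤ C * ((if s ⊆ γ then r ^ (γ \ s).card else 0) + u) := by
    split_ifs with hγ
    · exact (h.le_of_subset γ hγ).trans
        (mul_le_mul_of_nonneg_left (le_add_of_nonneg_right hu) hC)
    · simpa using h.le_of_not_subset γ hγ
  have superset_sum : ∑ γ ∈ Finset.univ.erase s, (if s ⊆ γ then r ^ (γ \ s).card else 0) ≤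
      (1 + r) ^ Fintype.card ι - 1 := by
    rw [Finset.sum_erase_eq_sub (Finset.mem_univ s), ← Finset.sum_filter,
      sum_superset_pow_card_sdiff]
    simp only [subset_refl, if_true, sdiff_self, Finset.bot_eq_empty, Finset.card_empty, pow_zero]
    gcongr
    · linarith
    · exact Finset.card_le_univ _
  have omit_sum : ∑ _γ ∈ Finset.univ.erase s, u ≤ 2 ^ Fintype.card ι * u := by
    rw [Finset.sum_const, nsmul_eq_mul]
    gcongr
    exact_mod_cast (Finset.card_le_univ _).trans_eq Fintype.card_finset
  calc ∑ γ ∈ Finset.univ.erase s, f γ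
      ≤ C * (∑ γ ∈ Finset.univ.erase s, (if s ⊆ γ then r ^ (γ \ s).card else 0) +
          ∑ _γ ∈ Finset.univ.erase s, u) := by
        rw [← Finset.sum_add_distrib, Finset.mul_sum]
        exact Finset.sum_le_sum fun γ _ => pointwise γ
    _ ≤ _ := by gcongr

end HasOddsBounds

end OddsBounds

section PosteriorOdds
variable {n p : ℕ} {X : Matrix (Fin n) (Fin p) ℝ} {β : Fin p → ℝ} {e : Fin n → ℝ}
  {δ σ φ a ν α₀ ψ ζ C : ℝ} {w : Finset (Fin p) → ℝ} {γ : Finset (Fin p)}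

/-- A bound on the factor by which each spurious covariate multiplies the posterior odds. -/
noncomputable def addBound (n p : ℕ) (ν φ a α₀ : ℝ) : ℝ :=
  √((p : ℝ) ^ (α₀ * (n + ν) / a) / (1 + n * φ))

/-- The logarithmic signal strength `(n + ν) log (n ψ² / (σ² ζ a))`: it measures, on the scale of
twice the log-likelihood, the loss incurred by omitting a coefficient of size at least `ψ`. -/
noncomputable def signalLog (n : ℕ) (ν σ ψ ζ a : ℝ) : ℝ :=
  (n + ν) * Real.log (n * ψ ^ 2 / (σ ^ 2 * ζ * a))

lemma addBound_nonneg : 0 ≤ addBound n p ν φ a α₀ :=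
  Real.sqrt_nonneg _

namespace IsLargeSample

lemma one_le_one_add (h : IsLargeSample n β δ σ φ a) : 1 ≤ 1 + n * φ :=
  le_add_of_nonneg_right (mul_nonneg n.cast_nonneg h.φ_pos.le)

lemma marginal_div_le_of_subset (h : IsLargeSample n β δ σ φ a) (hX : IsOrthogonalDesign X)
    (he : RegularNoise δ σ X e) (hν : 0 < ν) (hp : 0 < p)
    (hα : 2 * (1 + δ) ≤ α₀ * (1 - 3 * δ)) (hγ : supp β ⊆ γ) :
    marginal ν (fun _ => φ) X (X *ᵥ β + e) γ /
        marginal ν (fun _ => φ) X (X *ᵥ β + e) (supp β) ≤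
      addBound n p ν φ a α₀ ^ (γ \ supp β).card := by
  have hq : 0 < 1 + n * φ := zero_lt_one.trans_le h.one_le_one_add
  have hp' : (0 : ℝ) < p := by exact_mod_cast hp
  have hR := hX.shrunkRSS_nonneg h.φ_pos.le (X *ᵥ β + e) (supp β)
  have hR' := hX.shrunkRSS_nonneg h.φ_pos.le (X *ᵥ β + e) γ
  have rss_factor : ((1 + shrunkRSS φ X (X *ᵥ β + e) (supp β)) /
      (1 + shrunkRSS φ X (X *ᵥ β + e) γ)) ^ ((n + ν) / 2) ≤
        √((p : ℝ) ^ (α₀ * (n + ν) / a)) ^ (γ \ supp β).card := by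
    refine (Real.rpow_le_rpow (by positivity) (h.one_add_shrunkRSS_div_le_exp hX he hα γ)
      (by positivity)).trans_eq ?_
    rw [Real.sqrt_eq_rpow, ← Real.rpow_mul hp'.le, ← Real.rpow_natCast, ← Real.rpow_mul hp'.le,
      ← Real.exp_mul, Real.rpow_def_of_pos hp']
    ring_nf
  rw [hX.marginal_div hν h.φ_pos.le, ← Finset.card_sdiff_add_card_eq_card hγ, pow_add,
    div_mul_cancel_right₀ (by positivity), addBound, Real.sqrt_div' _ hq.le, div_pow,
    inv_mul_eq_div]
  gcongr

lemma one_add_shrunkRSS_div_rpow_le (h : IsLargeSample n β δ σ φ a) (hX : IsOrthogonalDesign X)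
    (he : RegularNoise δ σ X e) (hν : 0 < ν) (hζ : 0 < ζ)
    (hδζ : 1 + 3 * δ ≤ ζ * (1 - δ) ^ 2) (hψ : 0 < ψ) (hβ : ∀ j ∈ supp β, ψ ≤ |β j|)
    (hγ : ¬ supp β ⊆ γ) :
    ((1 + shrunkRSS φ X (X *ᵥ β + e) (supp β)) / (1 + shrunkRSS φ X (X *ᵥ β + e) γ)) ^
        ((n + ν) / 2) ≤ Real.exp (-(signalLog n ν σ ψ ζ a / 2)) := by
  have hn : (0 : ℝ) < n := by exact_mod_cast h.n_pos
  have hσ := h.σ_pos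
  have ha := h.a_pos
  have hR := hX.shrunkRSS_nonneg h.φ_pos.le (X *ᵥ β + e) (supp β)
  have hR' := hX.shrunkRSS_nonneg h.φ_pos.le (X *ᵥ β + e) γ
  set t := n * ψ ^ 2 / (σ ^ 2 * ζ * a) with ht
  have ht0 : 0 < t := by positivity
  have threshold : t * ((1 + 3 * δ) * (σ ^ 2 * a)) ≤ (1 - δ) ^ 2 * (n * ψ ^ 2) := by
    calc t * ((1 + 3 * δ) * (σ ^ 2 * a)) = (1 + 3 * δ) * (n * ψ ^ 2 / ζ) := by
          rw [ht]
          field_simp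
      _ ≤ ζ * (1 - δ) ^ 2 * (n * ψ ^ 2 / ζ) := by gcongr
      _ = (1 - δ) ^ 2 * (n * ψ ^ 2) := by field_simp
  have rss_ratio : (1 + shrunkRSS φ X (X *ᵥ β + e) (supp β)) /
      (1 + shrunkRSS φ X (X *ᵥ β + e) γ) ≤ t⁻¹ := by
    rw [div_le_iff₀ (by positivity), ← div_eq_inv_mul, le_div_iff₀' ht0]
    exact h.mul_one_add_shrunkRSS_supp_le hX he ht0.le hψ.le hβ threshold hγ
  refine (Real.rpow_le_rpow (by positivity) rss_ratio (by positivity)).trans_eq ?_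
  rw [Real.rpow_def_of_pos (inv_pos.2 ht0), Real.log_inv, signalLog, ← ht]
  ring_nf

lemma marginal_div_le_of_not_subset (h : IsLargeSample n β δ σ φ a) (hX : IsOrthogonalDesign X)
    (he : RegularNoise δ σ X e) (hν : 0 < ν) (hζ : 0 < ζ)
    (hδζ : 1 + 3 * δ ≤ ζ * (1 - δ) ^ 2) (hψ : 0 < ψ) (hβ : ∀ j ∈ supp β, ψ ≤ |β j|)
    (hs : 4 * ((supp β).card * Real.log (1 + n * φ)) ≤ signalLog n ν σ ψ ζ a)
    (hγ : ¬ supp β ⊆ γ) :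
    marginal ν (fun _ => φ) X (X *ᵥ β + e) γ /
        marginal ν (fun _ => φ) X (X *ᵥ β + e) (supp β) ≤
      Real.exp (-(signalLog n ν σ ψ ζ a / 4)) := by
  have hq : 0 < 1 + n * φ := zero_lt_one.trans_le h.one_le_one_add
  have size_factor : √(1 + n * φ) ^ (supp β).card / √(1 + n * φ) ^ γ.card ≤
      Real.exp ((supp β).card * Real.log (1 + n * φ) / 2) := by
    have hsqrt : 1 ≤ √(1 + n * φ) := Real.one_le_sqrt.2 h.one_le_one_add
    refine (div_le_self (by positivity) (one_le_pow₀ hsqrt)).trans_eq ?_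
    rw [mul_div_assoc, ← Real.log_sqrt hq.le, Real.exp_nat_mul, Real.exp_log (by positivity)]
  have hR := hX.shrunkRSS_nonneg h.φ_pos.le (X *ᵥ β + e) (supp β)
  have hR' := hX.shrunkRSS_nonneg h.φ_pos.le (X *ᵥ β + e) γ
  have hlog := mul_nonneg (supp β).card.cast_nonneg (Real.log_nonneg h.one_le_one_add)
  rw [hX.marginal_div hν h.φ_pos.le]
  refine (mul_le_mul size_factor (h.one_add_shrunkRSS_div_rpow_le hX he hν hζ hδζ hψ hβ hγ)
    (by positivity) (Real.exp_nonneg _)).trans ?_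
  rw [← Real.exp_add, Real.exp_le_exp]
  linarith

lemma hasOddsBounds (h : IsLargeSample n β δ σ φ a) (hX : IsOrthogonalDesign X)
    (he : RegularNoise δ σ X e) (hν : 0 < ν) (hp : 0 < p)
    (hα : 2 * (1 + δ) ≤ α₀ * (1 - 3 * δ)) (hζ : 0 < ζ)
    (hδζ : 1 + 3 * δ ≤ ζ * (1 - δ) ^ 2) (hψ : 0 < ψ) (hβ : ∀ j ∈ supp β, ψ ≤ |β j|)
    (hs : 4 * ((supp β).card * Real.log (1 + n * φ)) ≤ signalLog n ν σ ψ ζ a)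
    (hw : ∀ γ, 0 ≤ w γ) (hw₀ : 0 < w (supp β)) (hC : ∀ γ, w γ / w (supp β) ≤ C) :
    HasOddsBounds (posteriorOdds ν (fun _ => φ) w X (X *ᵥ β + e) (supp β)) (supp β) C
      (addBound n p ν φ a α₀) (Real.exp (-(signalLog n ν σ ψ ζ a / 4))) where
  le_of_subset _ hγ :=
    posteriorOdds_le (hX.marginal_pos hν h.φ_pos.le _) hw hw₀ hC
      (h.marginal_div_le_of_subset hX he hν hp hα hγ)
  le_of_not_subset _ hγ :=
    posteriorOdds_le (hX.marginal_pos hν h.φ_pos.le _) hw hw₀ hC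
      (h.marginal_div_le_of_not_subset hX he hν hζ hδζ hψ hβ hs hγ)

end IsLargeSample

end PosteriorOdds

/-! ### Consistency -/

lemma exists_slack {α₀ ζ : ℝ} (hα : 2 < α₀) (hζ : 1 < ζ) : ∃ δ : ℝ, 0 < δ ∧ δ ≤ 1 / 4 ∧
    2 * (1 + δ) ≤ α₀ * (1 - 3 * δ) ∧ 1 + 3 * δ ≤ ζ * (1 - δ) ^ 2 := by
  have small : ∀ᶠ δ : ℝ in 𝓝 0, δ < 1 / 4 := eventually_lt_nhds (by norm_num)
  have add_slack : ∀ᶠ δ : ℝ in 𝓝 0, 2 * (1 + δ) < α₀ * (1 - 3 * δ) :=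
    ContinuousAt.eventually_lt (by fun_prop) (by fun_prop) (by simpa using hα)
  have omit_slack : ∀ᶠ δ : ℝ in 𝓝 0, 1 + 3 * δ < ζ * (1 - δ) ^ 2 :=
    ContinuousAt.eventually_lt (by fun_prop) (by fun_prop) (by simpa using hζ)
  obtain ⟨δ, ⟨h, h', h''⟩, hδ⟩ := (((small.and (add_slack.and omit_slack)).filter_mono
    nhdsWithin_le_nhds).and (self_mem_nhdsWithin (s := Set.Ioi (0 : ℝ)))).exists
  exact ⟨δ, hδ, h.le, h'.le, h''.le⟩

section Limits
variable {ι : Type*} {l : Filter ι}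

lemma isLittleO_left_of_isLittleO_min {f u v : ι → ℝ} (hv : ∀ n, 0 ≤ v n)
    (h : f =o[l] fun n => min (u n) (v n)) : f =o[l] u := by
  refine h.trans_isBigO (.of_bound 1 (.of_forall fun n => ?_))
  rw [one_mul, Real.norm_eq_abs, Real.norm_eq_abs]
  obtain huv | hvu := le_total (u n) (v n)
  · rw [min_eq_left huv]
  · rw [min_eq_right hvu]
    exact abs_le_abs_of_nonneg (hv n) hvu

lemma tendstoInMeasure_const_of_abs_sub_le {Ω : Type*} [MeasurableSpace Ω] {P : Measure Ω}
    {f : ι → Ω → ℝ} {c : ℝ} {good : ι → Ω → Prop} {b : ι → ℝ}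
    (hgood : Tendsto (fun n => P {ω | ¬ good n ω}) l (𝓝 0)) (hb : Tendsto b l (𝓝 0))
    (h : ∀ᶠ n in l, ∀ᵐ ω ∂P, good n ω → |f n ω - c| ≤ b n) :
    TendstoInMeasure P f l fun _ => c := by
  rw [tendstoInMeasure_iff_dist]
  intro η hη
  refine tendsto_of_tendsto_of_tendsto_of_le_of_le' tendsto_const_nhds hgood
    (Eventually.of_forall fun _ => zero_le) ?_
  filter_upwards [h, hb.eventually_lt_const hη] with n hn hbn
  refine measure_mono_ae ?_
  filter_upwards [hn] with ω hω (hdist : η ≤ dist (f n ω) c) hgood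
  exact (hω hgood).not_gt (hbn.trans_le hdist)

lemma tendsto_sqrt_div_one_add {f u : ι → ℝ} (hfu : f =o[l] u) (hu : Tendsto u l atTop) :
    Tendsto (fun n => √(f n / (1 + u n))) l (𝓝 0) := by
  have hu' : u =O[l] fun n => 1 + u n := .of_bound 1 <| by
    filter_upwards [hu.eventually_ge_atTop 0] with n hn
    rw [Real.norm_of_nonneg hn, Real.norm_of_nonneg (by positivity)]
    linarith
  simpa using (hfu.trans_isBigO hu').tendsto_div_nhds_zero.sqrt

lemma tendsto_one_add_pow_sub_one {m : ι → ℕ} {r : ι → ℝ} (hr₀ : ∀ n, 0 ≤ r n)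
    (hr : Tendsto (fun n => (m n : ℝ) * r n) l (𝓝 0)) :
    Tendsto (fun n => (1 + r n) ^ m n - 1) l (𝓝 0) := by
  have exp_tendsto : Tendsto (fun n => Real.exp (m n * r n) - 1) l (𝓝 0) := by
    simpa using ((Real.continuous_exp.tendsto 0).comp hr).sub_const 1
  refine squeeze_zero (fun n => ?_) (fun n => ?_) exp_tendsto
  · exact sub_nonneg.2 (one_le_pow₀ (le_add_of_nonneg_right (hr₀ n)))
  · rw [Real.exp_nat_mul, add_comm 1]
    have := hr₀ n
    gcongr
    exact Real.add_one_le_exp _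

lemma two_pow_mul_exp_le {m : ℕ} {L : ℝ} (h : 8 * m ≤ L) :
    2 ^ m * Real.exp (-(L / 4)) ≤ Real.exp (-m) := by
  have two_le_exp : 2 ≤ Real.exp 1 := by linarith [Real.add_one_le_exp (1 : ℝ)]
  calc 2 ^ m * Real.exp (-(L / 4)) ≤ Real.exp 1 ^ m * Real.exp (-(L / 4)) := by gcongr
    _ = Real.exp (m - L / 4) := by rw [← Real.exp_nat_mul, ← Real.exp_add, mul_one, sub_eq_add_neg]
    _ ≤ Real.exp (-m) := Real.exp_le_exp.2 (by linarith)

end Limits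

/-- The asymptotic regime in which the true models are identifiable: the prior variances `φ n` are
not too small, the nonzero coefficients, of size at least `ψ n`, dominate the noise, and neither the
true models nor the numbers `p n` of covariates are too large. -/
structure IsConsistencyRegime (p : ℕ → ℕ) (β₀ : ∀ n, Fin (p n) → ℝ) (ν σ ζ : ℝ)
    (φ ψ a : ℕ → ℝ) : Prop where
  ν_pos : 0 < ν
  σ_pos : 0 < σ
  one_lt_ζ : 1 < ζ
  φ_pos : ∀ n, 0 < φ n
  ψ_pos : ∀ n, 0 < ψ n
  ψ_le : ∀ n, ∀ j ∈ supp (β₀ n), ψ n ≤ |β₀ n j|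
  a_eq : ∀ n, a n = scaleA σ n (energy (β₀ n)) (φ n)
  tendsto_p : Tendsto p atTop atTop
  tendsto_mul_φ : Tendsto (fun n : ℕ => n * φ n) atTop atTop
  lt_mul_sq : ∀ᶠ n : ℕ in atTop, σ ^ 2 * ζ * a n < n * ψ n ^ 2
  card_isLittleO : (fun n => ((supp (β₀ n)).card : ℝ)) =o[atTop]
    fun n => signalLog n ν σ (ψ n) ζ (a n) / Real.log (1 + n * φ n)
  mul_log_isLittleO : (fun n => (p n : ℝ) * Real.log (p n)) =o[atTop] a

namespace IsConsistencyRegime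
variable {p : ℕ → ℕ} {β₀ : ∀ n, Fin (p n) → ℝ} {ν σ ζ α₀ δ C : ℝ} {φ ψ a : ℕ → ℝ}
  {w : ∀ n, Finset (Fin (p n)) → ℝ}

lemma natCast_le_a (h : IsConsistencyRegime p β₀ ν σ ζ φ ψ a) (n : ℕ) : n ≤ a n :=
  h.a_eq n ▸ natCast_le_scaleA (energy_nonneg _) (h.φ_pos n).le

lemma eventually_noiseLevel_le (h : IsConsistencyRegime p β₀ ν σ ζ φ ψ a) (hδ : 0 < δ) :
    ∀ᶠ n in atTop, (2 + δ⁻¹) * (p n * noiseLevel δ σ (p n)) ≤ δ * (σ ^ 2 * a n) := by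
  have hc : 0 < δ / ((2 + δ⁻¹) * (2 * (1 + δ))) := by positivity
  filter_upwards [h.mul_log_isLittleO.bound hc] with n hn
  have log_bound := (Real.le_norm_self _).trans hn
  rw [Real.norm_of_nonneg (n.cast_nonneg.trans (h.natCast_le_a n))] at log_bound
  calc (2 + δ⁻¹) * (p n * noiseLevel δ σ (p n))
      = (2 + δ⁻¹) * (2 * (1 + δ)) * σ ^ 2 * (p n * Real.log (p n)) := by
        rw [noiseLevel]
        ring
    _ ≤ (2 + δ⁻¹) * (2 * (1 + δ)) * σ ^ 2 * (δ / ((2 + δ⁻¹) * (2 * (1 + δ))) * a n) := by gcongr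
    _ = δ * (σ ^ 2 * a n) := by field_simp

lemma eventually_isLargeSample (h : IsConsistencyRegime p β₀ ν σ ζ φ ψ a) (hδ : 0 < δ)
    (hδ' : δ ≤ 1 / 4) : ∀ᶠ n in atTop, IsLargeSample n (β₀ n) δ σ (φ n) (a n) := by
  have hσ := h.σ_pos
  filter_upwards [eventually_gt_atTop 0, h.eventually_noiseLevel_le hδ,
    tendsto_natCast_atTop_atTop.eventually_ge_atTop (δ * σ ^ 2)⁻¹,
    h.tendsto_mul_φ.eventually_ge_atTop δ⁻¹] with n hn noise_le inv_le_n inv_le_φ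
  refine ⟨hn, h.φ_pos n, hσ, hδ, hδ', h.a_eq n, noise_le, ?_, ?_⟩
  · rw [← mul_assoc]
    exact (inv_le_iff_one_le_mul₀' (by positivity)).1 (inv_le_n.trans (h.natCast_le_a n))
  · have := inv_le_of_inv_le₀ hδ (inv_le_φ.trans (le_add_of_nonneg_left zero_le_one))
    linarith [one_sub_shrinkage (n := n) (h.φ_pos n).le]

lemma eventually_signalLog_nonneg (h : IsConsistencyRegime p β₀ ν σ ζ φ ψ a) :
    ∀ᶠ n in atTop, 0 ≤ signalLog n ν σ (ψ n) ζ (a n) := by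
  filter_upwards [eventually_gt_atTop 0, h.lt_mul_sq] with n hn hψ
  have ha : 0 < a n := (Nat.cast_pos.2 hn).trans_le (h.natCast_le_a n)
  have hσ := h.σ_pos
  have hν := h.ν_pos
  have hζ := zero_lt_one.trans h.one_lt_ζ
  exact mul_nonneg (by positivity)
    (Real.log_nonneg ((one_le_div (by positivity)).2 hψ.le))

lemma eventually_card_mul_log_le (h : IsConsistencyRegime p β₀ ν σ ζ φ ψ a) :
    ∀ᶠ n in atTop, 4 * ((supp (β₀ n)).card * Real.log (1 + n * φ n)) ≤
      signalLog n ν σ (ψ n) ζ (a n) := by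
  filter_upwards [h.eventually_signalLog_nonneg, h.tendsto_mul_φ.eventually_gt_atTop 0,
    h.card_isLittleO.bound (c := 1 / 4) (by norm_num)] with n hL hφ hcard
  have hlog : 0 < Real.log (1 + n * φ n) := Real.log_pos (by linarith)
  rw [Real.norm_of_nonneg (Nat.cast_nonneg _), Real.norm_of_nonneg (by positivity),
    ← mul_div_assoc, le_div_iff₀ hlog] at hcard
  linarith

lemma exists_eventually_hasOddsBounds (h : IsConsistencyRegime p β₀ ν σ ζ φ ψ a) (hα : 2 < α₀)
    (hw : ∀ n γ, 0 ≤ w n γ) (hw₀ : ∀ n, 0 < w n (supp (β₀ n)))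
    (hC : ∀ n γ, w n γ / w n (supp (β₀ n)) ≤ C) :
    ∃ δ, 0 < δ ∧ ∀ᶠ n in atTop, ∀ (X : Matrix (Fin n) (Fin (p n)) ℝ) (e : Fin n → ℝ),
      IsOrthogonalDesign X → RegularNoise δ σ X e →
        HasOddsBounds (posteriorOdds ν (fun _ => φ n) (w n) X (X *ᵥ β₀ n + e) (supp (β₀ n)))
          (supp (β₀ n)) C (addBound n (p n) ν (φ n) (a n) α₀)
          (Real.exp (-(signalLog n ν σ (ψ n) ζ (a n) / 4))) := by
  obtain ⟨δ, hδ, hδ', hαδ, hζδ⟩ := exists_slack hα h.one_lt_ζ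
  refine ⟨δ, hδ, ?_⟩
  filter_upwards [h.eventually_isLargeSample hδ hδ', h.tendsto_p.eventually_gt_atTop 0,
    h.eventually_card_mul_log_le] with n hn hp hs X e hX he
  exact hn.hasOddsBounds hX he h.ν_pos hp hαδ (zero_lt_one.trans h.one_lt_ζ) hζδ (h.ψ_pos n)
    (h.ψ_le n) hs (hw n) (hw₀ n) (hC n)

lemma tendsto_addBound (h : IsConsistencyRegime p β₀ ν σ ζ φ ψ a)
    (hα : (fun n : ℕ => (p n : ℝ) ^ (α₀ * (n + ν) / a n)) =o[atTop] fun n : ℕ => n * φ n) :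
    Tendsto (fun n => addBound n (p n) ν (φ n) (a n) α₀) atTop (𝓝 0) :=
  tendsto_sqrt_div_one_add hα h.tendsto_mul_φ

lemma tendsto_mul_addBound (h : IsConsistencyRegime p β₀ ν σ ζ φ ψ a)
    (hα : (fun n : ℕ => (p n : ℝ) ^ (2 + α₀ * (n + ν) / a n)) =o[atTop] fun n : ℕ => n * φ n) :
    Tendsto (fun n => (p n : ℝ) * addBound n (p n) ν (φ n) (a n) α₀) atTop (𝓝 0) := by
  refine (tendsto_sqrt_div_one_add hα h.tendsto_mul_φ).congr' ?_
  filter_upwards [h.tendsto_p.eventually_gt_atTop 0] with n hp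
  have hp' : (0 : ℝ) < p n := by exact_mod_cast hp
  rw [addBound, Real.rpow_add hp', Real.rpow_two, mul_div_assoc, Real.sqrt_mul (sq_nonneg _),
    Real.sqrt_sq hp'.le]

lemma eventually_exp_signalLog_le (h : IsConsistencyRegime p β₀ ν σ ζ φ ψ a) :
    ∀ᶠ n in atTop, (supp (β₀ n)).Nonempty →
      Real.exp (-(signalLog n ν σ (ψ n) ζ (a n) / 4)) ≤ (1 + n * φ n)⁻¹ := by
  filter_upwards [h.eventually_card_mul_log_le, h.tendsto_mul_φ.eventually_gt_atTop 0]
    with n hs hφ hne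
  have hcard : (1 : ℝ) ≤ (supp (β₀ n)).card := by exact_mod_cast hne.card_pos
  have hlog : 0 < Real.log (1 + n * φ n) := Real.log_pos (by linarith)
  rw [← Real.exp_log (by positivity : 0 < (1 + n * φ n)⁻¹), Real.log_inv, Real.exp_le_exp,
    neg_le_neg_iff]
  linarith [le_mul_of_one_le_left hlog.le hcard]

lemma eventually_two_pow_mul_exp_le (h : IsConsistencyRegime p β₀ ν σ ζ φ ψ a)
    (hp : (fun n => (p n : ℝ)) =o[atTop] fun n => signalLog n ν σ (ψ n) ζ (a n)) :
    ∀ᶠ n in atTop, 2 ^ p n * Real.exp (-(signalLog n ν σ (ψ n) ζ (a n) / 4)) ≤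
      Real.exp (-p n) := by
  filter_upwards [hp.bound (c := 1 / 8) (by norm_num), h.eventually_signalLog_nonneg] with n hpn hL
  refine two_pow_mul_exp_le ?_
  rw [Real.norm_of_nonneg (Nat.cast_nonneg _), Real.norm_of_nonneg hL] at hpn
  linarith

section Probability
variable {Ω : Type*} [MeasurableSpace Ω] {P : Measure Ω}
  {X : ∀ n, Ω → Matrix (Fin n) (Fin (p n)) ℝ} {ε : ∀ n, Ω → Fin n → ℝ}

lemma tendstoInMeasure_maxOdds (h : IsConsistencyRegime p β₀ ν σ ζ φ ψ a)
    (hXX : ∀ n, ∀ᵐ ω ∂P, IsOrthogonalDesign (X n ω))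
    (hreg : ∀ δ, 0 < δ →
      Tendsto (fun n => P {ω | ¬ RegularNoise δ σ (X n ω) (ε n ω)}) atTop (𝓝 0))
    (hw : ∀ n γ, 0 ≤ w n γ) (hw₀ : ∀ n, 0 < w n (supp (β₀ n)))
    (hC : ∀ n γ, w n γ / w n (supp (β₀ n)) ≤ C) (hα₀ : 2 < α₀)
    (hα : (fun n : ℕ => (p n : ℝ) ^ (α₀ * (n + ν) / a n)) =o[atTop] fun n : ℕ => n * φ n) :
    TendstoInMeasure P (fun n ω => maxOdds ν (fun _ => φ n) (w n) (X n ω)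
      (X n ω *ᵥ β₀ n + ε n ω) (supp (β₀ n))) atTop fun _ => 0 := by
  obtain ⟨δ, hδ, hodds⟩ := h.exists_eventually_hasOddsBounds hα₀ hw hw₀ hC
  have bound_tendsto : Tendsto (fun n : ℕ =>
      C * (addBound n (p n) ν (φ n) (a n) α₀ + (1 + n * φ n)⁻¹)) atTop (𝓝 0) := by
    simpa using ((h.tendsto_addBound hα).add (tendsto_inv_atTop_zero.comp
      (tendsto_atTop_add_const_left _ 1 h.tendsto_mul_φ))).const_mul C
  refine tendstoInMeasure_const_of_abs_sub_le (hreg δ hδ) bound_tendsto ?_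
  filter_upwards [hodds, h.eventually_exp_signalLog_le,
    (h.tendsto_addBound hα).eventually_le_const zero_lt_one] with n hn hexp hadd
  filter_upwards [hXX n] with ω hX he
  have hC₀ := nonneg_of_forall_div_le (hw₀ n) (hC n)
  have hφ := h.φ_pos n
  rw [sub_zero, abs_of_nonneg (maxOdds_nonneg (hX.marginal_pos h.ν_pos hφ.le _) (hw n) _)]
  exact ((hn _ _ hX he).mono_right hC₀ hexp).iSup_le hC₀ addBound_nonneg hadd (by positivity)

lemma tendstoInMeasure_sum_posterior (h : IsConsistencyRegime p β₀ ν σ ζ φ ψ a)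
    (hXX : ∀ n, ∀ᵐ ω ∂P, IsOrthogonalDesign (X n ω))
    (hreg : ∀ δ, 0 < δ →
      Tendsto (fun n => P {ω | ¬ RegularNoise δ σ (X n ω) (ε n ω)}) atTop (𝓝 0))
    (hw : ∀ n γ, 0 ≤ w n γ) (hw₀ : ∀ n, 0 < w n (supp (β₀ n)))
    (hC : ∀ n γ, w n γ / w n (supp (β₀ n)) ≤ C)
    (hp : (fun n => (p n : ℝ)) =o[atTop] fun n => signalLog n ν σ (ψ n) ζ (a n)) (hα₀ : 2 < α₀)
    (hα : (fun n : ℕ => (p n : ℝ) ^ (2 + α₀ * (n + ν) / a n)) =o[atTop] fun n : ℕ => n * φ n) :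
    TendstoInMeasure P (fun n ω => ∑ γ ∈ Finset.univ.erase (supp (β₀ n)),
      posterior ν (fun _ => φ n) (w n) (X n ω) (X n ω *ᵥ β₀ n + ε n ω) γ) atTop fun _ => 0 := by
  obtain ⟨δ, hδ, hodds⟩ := h.exists_eventually_hasOddsBounds hα₀ hw hw₀ hC
  have bound_tendsto : Tendsto (fun n =>
      C * ((1 + addBound n (p n) ν (φ n) (a n) α₀) ^ p n - 1 + Real.exp (-p n))) atTop (𝓝 0) := by
    simpa using ((tendsto_one_add_pow_sub_one (fun _ => addBound_nonneg)
      (h.tendsto_mul_addBound hα)).add (Real.tendsto_exp_neg_atTop_nhds_zero.comp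
        (tendsto_natCast_atTop_atTop.comp h.tendsto_p))).const_mul C
  refine tendstoInMeasure_const_of_abs_sub_le (hreg δ hδ) bound_tendsto ?_
  filter_upwards [hodds, h.eventually_two_pow_mul_exp_le hp] with n hn hexp
  filter_upwards [hXX n] with ω hX he
  have hm := hX.marginal_pos h.ν_pos (h.φ_pos n).le (X n ω *ᵥ β₀ n + ε n ω)
  have hC₀ := nonneg_of_forall_div_le (hw₀ n) (hC n)
  have odds_sum := (hn _ _ hX he).sum_erase_le hC₀ addBound_nonneg (Real.exp_nonneg _)
  rw [Fintype.card_fin] at odds_sum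
  rw [sub_zero, abs_of_nonneg (Finset.sum_nonneg fun γ _ => posterior_nonneg hm (hw n) γ)]
  refine (Finset.sum_le_sum fun γ _ => posterior_le_posteriorOdds hm (hw n) (hw₀ n) γ).trans
    (odds_sum.trans ?_)
  gcongr

end Probability

end IsConsistencyRegime

lemma tendstoInMeasure_posterior_of_sum {Ω : Type*} [MeasurableSpace Ω] {P : Measure Ω}
    {p : ℕ → ℕ} {X : ∀ n, Ω → Matrix (Fin n) (Fin (p n)) ℝ} {y : ∀ n, Ω → Fin n → ℝ} {ν : ℝ}
    {φ : ℕ → ℝ} {w : ∀ n, Finset (Fin (p n)) → ℝ} {γ₀ : ∀ n, Finset (Fin (p n))}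
    (hXX : ∀ n, ∀ᵐ ω ∂P, IsOrthogonalDesign (X n ω)) (hν : 0 < ν) (hφ : ∀ n, 0 ≤ φ n)
    (hw : ∀ n γ, 0 ≤ w n γ) (hw₀ : ∀ n, 0 < w n (γ₀ n))
    (h : TendstoInMeasure P (fun n ω => ∑ γ ∈ Finset.univ.erase (γ₀ n),
      posterior ν (fun _ => φ n) (w n) (X n ω) (y n ω) γ) atTop fun _ => 0) :
    TendstoInMeasure P (fun n ω => posterior ν (fun _ => φ n) (w n) (X n ω) (y n ω) (γ₀ n))
      atTop fun _ => 1 := by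
  rw [tendstoInMeasure_iff_dist] at h ⊢
  refine fun η hη => (h η hη).congr fun n => measure_congr ?_
  filter_upwards [hXX n] with ω hX
  refine congrArg (η ≤ ·) ?_
  rw [sum_erase_posterior (hX.marginal_pos hν (hφ n) _) (hw n) (hw₀ n), Real.dist_eq, Real.dist_eq,
    sub_zero, abs_sub_comm]

end BVS

theorem mainTheorem4_general
    {Ω : Type*} [MeasurableSpace Ω] (P : Measure Ω) [IsProbabilityMeasure P]
    (p : ℕ → ℕ) (β₀ : ∀ n, Fin (p n) → ℝ)
    (X : ∀ n, Ω → Matrix (Fin n) (Fin (p n)) ℝ) (ε : ∀ n, Ω → Fin n → ℝ) {ν σ₀ ζ : ℝ}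
    {φ ψ a : ℕ → ℝ} (h : BVS.IsConsistencyRegime p β₀ ν σ₀ ζ φ ψ a)
    (hX : ∀ n, Measurable fun ω => (fun i j => X n ω i j : Fin n → Fin (p n) → ℝ))
    (hε : ∀ n, HasLaw (ε n) (BVS.noiseLaw n (σ₀ ^ 2)) P)
    (hind : ∀ n, IndepFun (fun ω => (fun i j => X n ω i j : Fin n → Fin (p n) → ℝ)) (ε n) P)
    (hXX : ∀ n, ∀ᵐ ω ∂P, BVS.IsOrthogonalDesign (X n ω))
    (w : ∀ n, Finset (Fin (p n)) → ℝ) (hw : ∀ n γ, 0 ≤ w n γ)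
    (hw_true : ∀ n, 0 < w n (BVS.supp (β₀ n))) {C : ℝ}
    (hw_odds : ∀ n γ, w n γ / w n (BVS.supp (β₀ n)) ≤ C) :
    ((∃ α₀ : ℝ, 2 < α₀ ∧
        (fun n : ℕ => (p n : ℝ) ^ (α₀ * (n + ν) / a n)) =o[atTop] fun n : ℕ => (n : ℝ) * φ n) →
      TendstoInMeasure P
        (fun n ω => BVS.maxOdds ν (fun _ => φ n) (w n) (X n ω)
          ((X n ω).mulVec (β₀ n) + ε n ω) (BVS.supp (β₀ n)))
        atTop (fun _ => (0 : ℝ))) ∧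
    ((fun n : ℕ => (p n : ℝ)) =o[atTop] (fun n : ℕ => BVS.signalLog n ν σ₀ (ψ n) ζ (a n)) →
      (∃ α₀ : ℝ, 2 < α₀ ∧
        (fun n : ℕ => (p n : ℝ) ^ (2 + α₀ * (n + ν) / a n)) =o[atTop]
          fun n : ℕ => (n : ℝ) * φ n) →
      TendstoInMeasure P
        (fun n ω => ∑ γ ∈ Finset.univ.erase (BVS.supp (β₀ n)),
          BVS.posterior ν (fun _ => φ n) (w n) (X n ω) ((X n ω).mulVec (β₀ n) + ε n ω) γ)
        atTop (fun _ => (0 : ℝ)) ∧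
      TendstoInMeasure P
        (fun n ω => BVS.posterior ν (fun _ => φ n) (w n) (X n ω)
          ((X n ω).mulVec (β₀ n) + ε n ω) (BVS.supp (β₀ n)))
        atTop (fun _ => (1 : ℝ))) := by
  have regular (δ : ℝ) (hδ : 0 < δ) :=
    BVS.tendsto_measure_not_regularNoise hδ h.σ_pos hX hε hind hXX h.tendsto_p
  refine ⟨fun ⟨_, hα₀, hα⟩ => h.tendstoInMeasure_maxOdds hXX regular hw hw_true hw_odds hα₀ hα,
    fun hp ⟨_, hα₀, hα⟩ => ?_⟩
  have hsum := h.tendstoInMeasure_sum_posterior hXX regular hw hw_true hw_odds hp hα₀ hα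
  exact ⟨hsum, BVS.tendstoInMeasure_posterior_of_sum hXX h.ν_pos (fun n => (h.φ_pos n).le) hw
    hw_true hsum⟩

theorem mainTheorem4
    {Ω : Type*} [MeasurableSpace Ω] (P : Measure Ω) [IsProbabilityMeasure P]
    -- dimension, true coefficients, design matrix and errors at sample size `n`
    (p : ℕ → ℕ) (β₀ : ∀ n, Fin (p n) → ℝ)
    (X : ∀ n, Ω → Matrix (Fin n) (Fin (p n)) ℝ) (ε : ∀ n, Ω → Fin n → ℝ) (σ₀ : ℝ) (hσ₀ : 0 < σ₀)
    (hX : ∀ n, Measurable fun ω => (fun i j => X n ω i j : Fin n → Fin (p n) → ℝ))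
    (hε : ∀ n, HasLaw (ε n) (BVS.noiseLaw n (σ₀ ^ 2)) P)
    (hind : ∀ n, IndepFun (fun ω => (fun i j => X n ω i j : Fin n → Fin (p n) → ℝ)) (ε n) P)
    -- hyperparameters and prior on the models
    (ν : ℝ) (hν : 0 < ν) (φ : ℕ → ℝ) (hφ : ∀ n, 0 < φ n)
    (w : ∀ n, Finset (Fin (p n)) → ℝ) (hw : ∀ n γ, 0 ≤ w n γ) (hw_sum : ∀ n, ∑ γ, w n γ = 1)
    -- orthogonal design
    (hXX : ∀ n, ∀ᵐ ω ∂P, (X n ω).transpose * X n ω = (n : ℝ) • (1 : Matrix _ _ ℝ))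
    -- prior variances
    (hnφ : Tendsto (fun n : ℕ => (n : ℝ) * φ n) atTop atTop)
    (hlogφ : (fun n : ℕ => Real.log (φ n)) =O[atTop] fun n : ℕ => Real.log n)
    -- the true model is nonnull, and its coefficients are bounded away from zero by `ψ n`
    (hnonnull : ∀ᶠ n in atTop, (BVS.supp (β₀ n)).Nonempty)
    (ψ : ℕ → ℝ) (hψ : ∀ n, 0 < ψ n) (hβψ : ∀ n, ∀ j ∈ BVS.supp (β₀ n), ψ n ≤ |β₀ n j|)
    -- bounded prior odds against the true model
    (C₀ : ℝ) (hC₀ : 0 < C₀) (hw_true : ∀ n, 0 < w n (BVS.supp (β₀ n)))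
    (hw_odds : ∀ n γ, w n γ / w n (BVS.supp (β₀ n)) ≤ C₀)
    -- growth conditions
    (a : ℕ → ℝ) (ha : ∀ n, a n = BVS.scaleA σ₀ n (BVS.energy (β₀ n)) (φ n))
    (ζ : ℝ) (hζ : 1 < ζ) (hψa : ∀ᶠ n : ℕ in atTop, σ₀ ^ 2 * ζ * a n < n * ψ n ^ 2)
    (hp : Tendsto p atTop atTop) (hpn : ∀ n, p n ≤ n)
    (hs : (fun n : ℕ => ((BVS.supp (β₀ n)).card : ℝ)) =o[atTop] fun n : ℕ =>
      min (min ((n + ν) * Real.log (n * ψ n ^ 2 / (σ₀ ^ 2 * ζ * a n)) / Real.log (1 + n * φ n))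
        (n * ψ n ^ 2)) n)
    (hpa : (fun n : ℕ => (p n : ℝ) * Real.log (p n)) =o[atTop] a) :
    ((∃ α₀ : ℝ, 2 < α₀ ∧
        (fun n : ℕ => (p n : ℝ) ^ (α₀ * (n + ν) / a n)) =o[atTop] fun n : ℕ => (n : ℝ) * φ n) →
      TendstoInMeasure P
        (fun n ω => BVS.maxOdds ν (fun _ => φ n) (w n) (X n ω)
          ((X n ω).mulVec (β₀ n) + ε n ω) (BVS.supp (β₀ n)))
        atTop (fun _ => (0 : ℝ))) ∧
    ((fun n : ℕ => (p n : ℝ)) =o[atTop]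
        (fun n : ℕ => (n + ν) * Real.log (n * ψ n ^ 2 / (σ₀ ^ 2 * ζ * a n))) →
      (∃ α₀ : ℝ, 2 < α₀ ∧
        (fun n : ℕ => (p n : ℝ) ^ (2 + α₀ * (n + ν) / a n)) =o[atTop]
          fun n : ℕ => (n : ℝ) * φ n) →
      TendstoInMeasure P
        (fun n ω => ∑ γ ∈ Finset.univ.erase (BVS.supp (β₀ n)),
          BVS.posterior ν (fun _ => φ n) (w n) (X n ω) ((X n ω).mulVec (β₀ n) + ε n ω) γ)
        atTop (fun _ => (0 : ℝ)) ∧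
      TendstoInMeasure P
        (fun n ω => BVS.posterior ν (fun _ => φ n) (w n) (X n ω)
          ((X n ω).mulVec (β₀ n) + ε n ω) (BVS.supp (β₀ n)))
        atTop (fun _ => (1 : ℝ))) := by
  have card_isLittleO := BVS.isLittleO_left_of_isLittleO_min (fun n => by positivity)
    (BVS.isLittleO_left_of_isLittleO_min (fun n => n.cast_nonneg) hs)
  exact mainTheorem4_general P p β₀ X ε
    ⟨hν, hσ₀, hζ, hφ, hψ, hβψ, ha, hp, hnφ, hψa, card_isLittleO, hpa⟩ hX hε hind hXX w hw hw_true
    hw_odds
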